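/- Let $A=\mathrm{PSL}(2,\mathbb C)=\mathrm{SL}(2,\mathbb C)/\{\pm I\}$, regarded as a complex affine algebraic group, let $p,t$ be positive integers and let $G_{pt}=\langle x,y \mid x^p=y^t\rangle$. Let $R_A(G_{pt})=\mathrm{Hom}(G_{pt},A)$ be the representation variety of $G_{pt}$ over $A$, that is, the algebraic set obtained by identifying $\rho\in\mathrm{Hom}(G_{pt},A)$ with the point $(\rho(x),\rho(y))\in A^2$, with its Zariski topology. For an algebraic variety $V$ (not necessarily irreducible) let $N_4(V)$ be the number of irreducible components of $V$ of dimension exactly $4$. Then $N_4(R_A(G_{pt}))$ is finite and equals 1. $\dfrac{(p-1)(t-1)}{4}$ if both $p$ and $t$ are odd; 2. $\dfrac{p(t-1)}{4}$ if $p$ is even and $t$ is odd; 3. $\dfrac{t(p-1)}{4}$ if $p$ is odd and $t$ is even; 4. $\dfrac{pt}{4}$ if both $p$ and $t$ are even. -/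

import Mathlib

/-- The Zariski topology on a set `X` equipped with a `ℂ`-algebra `R` of (regular) functions
`X → ℂ`: the closed sets are the common zero loci of the subsets of `R`. -/
@[reducible] def zariskiTopology {X : Type} (R : Subalgebra ℂ (X → ℂ)) : TopologicalSpace X :=
  TopologicalSpace.ofClosed
    {Z : Set X | ∃ S : Set (X → ℂ), S ⊆ (R : Set (X → ℂ)) ∧ Z = {x | ∀ f ∈ S, f x = 0}}
    ⟨{1}, by
      simp, by
      ext x; simp⟩
    (by
      intro A hA
      refine ⟨{f | f ∈ R ∧ ∃ Z ∈ A, ∀ x ∈ Z, f x = 0}, fun f hf => hf.1, ?_⟩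
      ext x
      constructor
      · rintro hx f ⟨-, Z, hZ, hf⟩
        exact hf x (hx Z hZ)
      · intro hx Z hZ
        obtain ⟨S, hS, rfl⟩ := hA hZ
        exact fun f hf => hx f ⟨hS hf, _, hZ, fun y hy => hy f hf⟩)
    (by
      rintro _ ⟨S, hS, rfl⟩ _ ⟨T, hT, rfl⟩
      refine ⟨{h | ∃ f ∈ S, ∃ g ∈ T, h = f * g}, ?_, ?_⟩
      · rintro _ ⟨f, hf, g, hg, rfl⟩
        exact R.mul_mem (hS hf) (hT hg)
      · ext x
        constructor
        · rintro (hx | hx) _ ⟨f, hf, g, hg, rfl⟩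
          · simp [hx f hf]
          · simp [hx g hg]
        · intro hx
          by_contra hcon
          simp only [Set.mem_union, Set.mem_ofPred_eq, not_or, not_forall] at hcon
          obtain ⟨⟨f, hf, hfx⟩, ⟨g, hg, hgx⟩⟩ := hcon
          exact mul_ne_zero hfx hgx (hx _ ⟨f, hf, g, hg, rfl⟩))

/-- The group `PSL(2, ℂ)`, the quotient of `SL(2, ℂ)` by its center `{I, -I}`. -/
abbrev PSL2C : Type := Matrix.ProjectiveSpecialLinearGroup (Fin 2) ℂ

/-- The product `PSL(2, ℂ)ⁿ`, as a type of its own so that it can carry the Zariski topology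
(and not the product of the classical topologies). -/
def PSL2CPow (n : ℕ) : Type := Fin n → PSL2C

/-- The canonical projection `SL(2, ℂ)ⁿ → PSL(2, ℂ)ⁿ`. -/
def projPow (n : ℕ) (g : Fin n → Matrix.SpecialLinearGroup (Fin 2) ℂ) : PSL2CPow n :=
  fun i => (QuotientGroup.mk (g i) : PSL2C)

/-- The coordinate algebra of the affine variety `PSL(2, ℂ)ⁿ = SL(2, ℂ)ⁿ / {I, -I}ⁿ`: a function
is regular iff its pullback to `SL(2, ℂ)ⁿ` is a polynomial in the matrix entries. -/
def regularFunctions (n : ℕ) : Subalgebra ℂ (PSL2CPow n → ℂ) where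
  carrier := {f | ∃ P : MvPolynomial (Fin n × Fin 2 × Fin 2) ℂ,
    ∀ g : Fin n → Matrix.SpecialLinearGroup (Fin 2) ℂ,
      f (projPow n g) = MvPolynomial.eval (fun k => (g k.1).1 k.2.1 k.2.2) P}
  mul_mem' := by
    rintro f f' ⟨P, hP⟩ ⟨P', hP'⟩
    exact ⟨P * P', fun g => by simp [hP, hP']⟩
  add_mem' := by
    rintro f f' ⟨P, hP⟩ ⟨P', hP'⟩
    exact ⟨P + P', fun g => by simp [hP, hP']⟩
  algebraMap_mem' := fun c => ⟨MvPolynomial.C c, fun g => by simp⟩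

instance PSL2CPow.instTopologicalSpace (n : ℕ) : TopologicalSpace (PSL2CPow n) :=
  zariskiTopology (regularFunctions n)

/-- The representation variety `R_A(G) = Hom(G, A)` for `A = PSL(2, ℂ)`, where the group `G` is
generated by `s 0, …, s (n - 1)`. -/
def RepVariety {G : Type} [Group G] {n : ℕ} (_s : Fin n → G) : Type := G →* PSL2C

/-- The inclusion `Hom(G, A) → Aⁿ`, `ρ ↦ (ρ (s 0), …, ρ (s (n - 1)))`, for `A = PSL(2, ℂ)`. -/
def RepVariety.toPow {G : Type} [Group G] {n : ℕ} (s : Fin n → G) (ρ : RepVariety s) :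
    PSL2CPow n :=
  fun i => (show G →* PSL2C from ρ) (s i)

/-- The Zariski topology of `R_A(G)` is the subspace topology from `Aⁿ`. -/
instance RepVariety.instTopologicalSpace {G : Type} [Group G] {n : ℕ} (s : Fin n → G) :
    TopologicalSpace (RepVariety s) :=
  TopologicalSpace.induced (RepVariety.toPow s) inferInstance

/-- `N_d(X)`: the number of irreducible components of `X` of (Krull) dimension exactly `d`. -/
noncomputable def numComponents (X : Type) [TopologicalSpace X] (d : ℕ) : ℕ∞ :=
  {Z ∈ irreducibleComponents X | topologicalKrullDim Z = (d : WithBot ℕ∞)}.encard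

/-- The group `G_{pt} = ⟨x, y ; x ^ p = y ^ t⟩`, with `x`, `y` the generators `0`, `1`. -/
abbrev torusGroup (p t : ℕ) : Type :=
  PresentedGroup
    ({FreeGroup.of 0 ^ p * (FreeGroup.of 1 ^ t)⁻¹} : Set (FreeGroup (Fin 2)))

/-- The generators `x`, `y` of `G_{pt}`. -/
def torusGroupGen (p t : ℕ) : Fin 2 → torusGroup p t :=
  fun i => PresentedGroup.of i

/-!
Lift the values of a representation at the generators `x`, `y` to `SL(2, ℂ)`. If the lifts commute,
they lie in a common pencil `α + x C` with `C` of rank at most one, so the representation is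
unipotent or has values in a maximal torus. Both kinds form sets of dimension at most `3`: the first
is described by a line in `ℂ²` and a pair of scalars, the second by a maximal torus, which has two
parameters, and a solution of `a ^ p = ± b ^ t`. If the lifts do not commute, then `x ^ p = ± y ^ t`
commutes with both, hence is `± 1`; neither lift is scalar, so the squared traces take one of `⌊p /
2⌋` and one of `⌊t / 2⌋` values. The representations with given such squared traces form a closed
set, irreducible of dimension `4` because it is parametrized by the pairs of idempotents of rank
one.

Dimensions are bounded above by algebraic dependence of functions, and below by the chain of images
of coordinate subspaces under a chart.
-/

section FunctionAlgebras

variable {k : Type*} [Field k] {X Y σ τ : Type*}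

lemma aeval_pi_apply (f : σ → Y → k) (P : MvPolynomial σ k) (y : Y) :
    MvPolynomial.aeval f P y = MvPolynomial.eval (fun i => f i y) P := by
  have h := MvPolynomial.comp_aeval_apply f (Pi.evalAlgHom k (fun _ : Y => k) y) P
  rwa [MvPolynomial.aeval_eq_eval] at h

lemma aeval_mem {A : Type*} [CommSemiring A] [Algebra k A] {F : Subalgebra k A} {f : σ → A}
    (hf : ∀ i, f i ∈ F) (P : MvPolynomial σ k) : MvPolynomial.aeval f P ∈ F := by
  have hle : Algebra.adjoin k (Set.range f) ≤ F := Algebra.adjoin_le (Set.range_subset_iff.2 hf)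
  rw [Algebra.adjoin_range_eq_range_aeval] at hle
  exact hle ⟨P, rfl⟩

lemma eval_aeval (E : σ → MvPolynomial τ k) (P : MvPolynomial σ k) (z : τ → k) :
    MvPolynomial.eval z (MvPolynomial.aeval E P) =
      MvPolynomial.eval (fun i => MvPolynomial.eval z (E i)) P := by
  have h := MvPolynomial.comp_aeval_apply E (MvPolynomial.aeval (R := k) z) P
  simpa only [MvPolynomial.aeval_eq_eval] using h

/-- Composition with `φ : Y → X`, as a homomorphism from the functions on `X` to the functions on
`Y`. -/
def pullback (φ : Y → X) : (X → k) →ₐ[k] (Y → k) :=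
  AlgHom.pi fun y => Pi.evalAlgHom k (fun _ => k) (φ y)

lemma pullback_apply (φ : Y → X) (f : X → k) (y : Y) : pullback φ f y = f (φ y) := rfl

/-! ### Relations transporting regular functions -/

/-- A relation `r` between two sets carrying algebras of functions is regular if every function `f`
of `F` is computed along `r` by a function of `G`. The graph of a morphism is regular, and so is a
parametrization by coordinates that only determine some auxiliary choice, such as a lift. -/
def IsRegularRel (G : Subalgebra k (X → k)) (F : Subalgebra k (Y → k)) (r : X → Y → Prop) : Prop :=
  ∀ f ∈ F, ∃ g ∈ G, ∀ x y, r x y → f y = g x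

/-- The functions of `F` satisfy the defining properties of an integral domain when restricted to
`S`. For an algebra of regular functions this says that `S` is irreducible. -/
def IsDomainOn (F : Subalgebra k (Y → k)) (S : Set Y) : Prop :=
  S.Nonempty ∧ ∀ f ∈ F, ∀ g ∈ F, (∀ y ∈ S, f y * g y = 0) →
    (∀ y ∈ S, f y = 0) ∨ ∀ y ∈ S, g y = 0

/-- The set `S` has dimension less than `n`, in the sense that any `n` functions of `F` satisfy a
nontrivial polynomial relation on `S`. -/
def DimLT (F : Subalgebra k (Y → k)) (n : ℕ) (S : Set Y) : Prop :=
  ∀ f : Fin n → Y → k, (∀ i, f i ∈ F) →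
    ∃ P : MvPolynomial (Fin n) k, P ≠ 0 ∧ ∀ y ∈ S, MvPolynomial.eval (fun i => f i y) P = 0

variable {G : Subalgebra k (X → k)} {F : Subalgebra k (Y → k)}

lemma IsRegularRel.isDomainOn {r : X → Y → Prop} (hr : IsRegularRel G F r) {D : Set X} {S : Set Y}
    (hD : IsDomainOn G D) (hDS : ∀ x ∈ D, ∃ y ∈ S, r x y) (hSD : ∀ y ∈ S, ∃ x ∈ D, r x y) :
    IsDomainOn F S := by
  have transfer {f : Y → k} {g : X → k} (hfg : ∀ x y, r x y → f y = g x) :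
      (∀ y ∈ S, f y = 0) ↔ ∀ x ∈ D, g x = 0 := by
    refine ⟨fun h x hx => ?_, fun h y hy => ?_⟩
    · obtain ⟨y, hy, hxy⟩ := hDS x hx
      rw [← hfg x y hxy, h y hy]
    · obtain ⟨x, hx, hxy⟩ := hSD y hy
      rw [hfg x y hxy, h x hx]
  obtain ⟨x, hx⟩ := hD.1
  obtain ⟨y, hy, -⟩ := hDS x hx
  refine ⟨⟨y, hy⟩, fun f₁ hf₁ f₂ hf₂ h => ?_⟩
  obtain ⟨g₁, hg₁, h₁⟩ := hr f₁ hf₁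
  obtain ⟨g₂, hg₂, h₂⟩ := hr f₂ hf₂
  rw [transfer h₁, transfer h₂]
  exact hD.2 g₁ hg₁ g₂ hg₂
    ((transfer (f := f₁ * f₂) (g := g₁ * g₂) fun x y hxy => by
      rw [Pi.mul_apply, Pi.mul_apply, h₁ x y hxy, h₂ x y hxy]).1 h)

lemma IsRegularRel.dimLT {r : X → Y → Prop} (hr : IsRegularRel G F r) {n : ℕ} {D : Set X}
    {S : Set Y} (hD : DimLT G n D) (hSD : ∀ y ∈ S, ∃ x ∈ D, r x y) : DimLT F n S := by
  intro f hf
  choose g hg hfg using fun i => hr (f i) (hf i)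
  obtain ⟨P, hP, hPD⟩ := hD g hg
  refine ⟨P, hP, fun y hy => ?_⟩
  obtain ⟨x, hx, hxy⟩ := hSD y hy
  simp only [hfg _ x y hxy]
  exact hPD x hx

lemma isRegularRel_pullback (φ : Y → X) :
    IsRegularRel G (G.map (pullback φ)) fun x y => φ y = x := by
  rintro _ ⟨g, hg, rfl⟩
  exact ⟨g, hg, fun x y hxy => by rw [← hxy]; rfl⟩

lemma IsRegularRel.comp_pullback {Z : Type*} {r : X → Y → Prop} (hr : IsRegularRel G F r)
    (φ : Z → Y) : IsRegularRel G (F.map (pullback φ)) fun x z => r x (φ z) := by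
  rintro _ ⟨f, hf, rfl⟩
  obtain ⟨g, hg, hfg⟩ := hr f hf
  exact ⟨g, hg, fun x z => hfg x (φ z)⟩

namespace DimLT

variable {n : ℕ} {S T : Set Y}

lemma mono (hT : DimLT F n T) (hST : S ⊆ T) : DimLT F n S := fun f hf =>
  (hT f hf).imp fun _ hP => ⟨hP.1, fun y hy => hP.2 y (hST hy)⟩

lemma iUnion {ι : Type*} [Finite ι] {S : ι → Set Y} (hS : ∀ i, DimLT F n (S i)) :
    DimLT F n (⋃ i, S i) := by
  intro f hf
  have := Fintype.ofFinite ι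
  choose P hP hPS using fun i => hS i f hf
  refine ⟨∏ i, P i, Finset.prod_ne_zero_iff.2 fun i _ => hP i, fun y hy => ?_⟩
  obtain ⟨i, hi⟩ := Set.mem_iUnion.1 hy
  rw [map_prod]
  exact Finset.prod_eq_zero (Finset.mem_univ i) (hPS i y hi)

lemma union (hS : DimLT F n S) (hT : DimLT F n T) : DimLT F n (S ∪ T) := by
  rw [Set.union_eq_iUnion]
  exact iUnion (Bool.forall_bool.2 ⟨hT, hS⟩)

lemma of_finite_charts {ι : Type*} {I : Set ι} (hI : I.Finite) {r : ι → X → Y → Prop}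
    (hr : ∀ i ∈ I, IsRegularRel G F (r i)) {D : Set X} (hD : DimLT G n D)
    (hS : ∀ y ∈ S, ∃ i ∈ I, ∃ x ∈ D, r i x y) : DimLT F n S := by
  have := hI.to_subtype
  have hunion : DimLT F n (⋃ i : I, {y | ∃ x ∈ D, r i x y}) :=
    iUnion fun i => (hr i i.2).dimLT hD fun y hy => hy
  refine hunion.mono fun y hy => ?_
  obtain ⟨i, hi, hx⟩ := hS y hy
  exact Set.mem_iUnion.2 ⟨⟨i, hi⟩, hx⟩

lemma eq_empty (hS : DimLT F 0 S) : S = ∅ := by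
  obtain ⟨P, hP, hPS⟩ := hS Fin.elim0 fun i => i.elim0
  refine Set.eq_empty_iff_forall_notMem.2 fun y hy => hP ?_
  have h := hPS y hy
  rw [MvPolynomial.eq_C_of_isEmpty P, MvPolynomial.eval_C] at h
  rw [MvPolynomial.eq_C_of_isEmpty P, h, MvPolynomial.C_0]

end DimLT

/-! ### Cutting by a hypersurface -/

lemma exists_eq_X_zero_pow_mul {n : ℕ} {P : MvPolynomial (Fin (n + 1)) k} (hP : P ≠ 0) :
    ∃ (m : ℕ) (Q : MvPolynomial (Fin (n + 1)) k), P = MvPolynomial.X 0 ^ m * Q ∧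
      (MvPolynomial.finSuccEquiv k n Q).coeff 0 ≠ 0 := by
  obtain ⟨q, hq, hXq⟩ := Polynomial.exists_eq_pow_rootMultiplicity_mul_and_not_dvd
    (MvPolynomial.finSuccEquiv k n P) ((map_ne_zero_iff _ (AlgEquiv.injective _)).2 hP) 0
  rw [Polynomial.C_0, sub_zero] at hq hXq
  refine ⟨Polynomial.rootMultiplicity 0 (MvPolynomial.finSuccEquiv k n P),
    (MvPolynomial.finSuccEquiv k n).symm q, ?_, ?_⟩
  · apply (MvPolynomial.finSuccEquiv k n).injective
    rw [map_mul, map_pow, MvPolynomial.finSuccEquiv_X_zero, AlgEquiv.apply_symm_apply]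
    exact hq
  · rwa [AlgEquiv.apply_symm_apply, ne_eq, ← Polynomial.X_dvd_iff]

lemma eval_coeff_zero_finSuccEquiv {n : ℕ} (Q : MvPolynomial (Fin (n + 1)) k) (s : Fin n → k) :
    MvPolynomial.eval s ((MvPolynomial.finSuccEquiv k n Q).coeff 0) =
      MvPolynomial.eval (Fin.cons 0 s : Fin (n + 1) → k) Q := by
  rw [MvPolynomial.eval_eq_eval_mv_eval', ← Polynomial.coeff_zero_eq_eval_zero,
    Polynomial.coeff_map]

lemma IsDomainOn.dimLT_zeros {n : ℕ} {W : Set Y} (hW : IsDomainOn F W) (hdim : DimLT F (n + 1) W)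
    {h : Y → k} (hF : h ∈ F) (hne : ∃ y ∈ W, h y ≠ 0) : DimLT F n (W ∩ {y | h y = 0}) := by
  intro f hf
  have hcons : ∀ i, (Fin.cons h f : Fin (n + 1) → Y → k) i ∈ F := Fin.cons hF hf
  obtain ⟨P, hP, hPW⟩ := hdim _ hcons
  obtain ⟨m, Q, rfl, hQ⟩ := exists_eq_X_zero_pow_mul hP
  -- On `W` the power of `h` cancels from the relation, after which `h` can be set to zero.
  have hQW : ∀ y ∈ W, MvPolynomial.aeval (Fin.cons h f : Fin (n + 1) → Y → k) Q y = 0 := by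
    refine (hW.2 (h ^ m) (F.pow_mem hF m) _ (aeval_mem hcons Q) fun y hy => ?_).resolve_left ?_
    · rw [aeval_pi_apply, Pi.pow_apply, ← hPW y hy, map_mul, map_pow, MvPolynomial.eval_X,
        Fin.cons_zero]
    · obtain ⟨y, hy, hhy⟩ := hne
      exact fun h0 => pow_ne_zero m hhy (h0 y hy)
  refine ⟨_, hQ, fun y hy => ?_⟩
  rw [eval_coeff_zero_finSuccEquiv]
  refine Eq.trans ?_ (hQW y hy.1)
  rw [aeval_pi_apply]
  refine congrArg (MvPolynomial.eval · Q) (funext fun i => ?_)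
  induction i using Fin.cases with
  | zero => exact hy.2.symm
  | succ i => rfl

/-! ### Polynomial functions on affine space -/

/-- The coordinate algebra of the affine space `σ → k`. -/
noncomputable def mvPolynomialFunctions (σ k : Type*) [Field k] : Subalgebra k ((σ → k) → k) :=
  (MvPolynomial.aeval fun i (z : σ → k) => z i).range

lemma mem_mvPolynomialFunctions {f : (σ → k) → k} :
    f ∈ mvPolynomialFunctions σ k ↔ ∃ P : MvPolynomial σ k, ∀ z, f z = MvPolynomial.eval z P := by
  refine exists_congr fun P => ?_
  change MvPolynomial.aeval _ P = f ↔ _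
  simp only [funext_iff, aeval_pi_apply, eq_comm]

lemma isDomainOn_mvPolynomialFunctions [Infinite k] :
    IsDomainOn (mvPolynomialFunctions σ k) Set.univ := by
  refine ⟨⟨0, trivial⟩, fun f hf g hg h => ?_⟩
  obtain ⟨P, hP⟩ := mem_mvPolynomialFunctions.1 hf
  obtain ⟨Q, hQ⟩ := mem_mvPolynomialFunctions.1 hg
  have hPQ : P * Q = 0 := MvPolynomial.funext fun z => by
    rw [map_mul, ← hP, ← hQ, h z trivial, map_zero]
  refine (mul_eq_zero.1 hPQ).imp (fun h0 z _ => ?_) fun h0 z _ => ?_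
  · rw [hP, h0, map_zero]
  · rw [hQ, h0, map_zero]

lemma dimLT_mvPolynomialFunctions [Fintype σ] :
    DimLT (mvPolynomialFunctions σ k) (Fintype.card σ + 1) Set.univ := by
  intro f hf
  choose p hp using fun i => mem_mvPolynomialFunctions.1 (hf i)
  have hdep : ¬ AlgebraicIndependent k p := fun hind => by
    have hle := hind.lift_cardinalMk_le_trdeg
    rw [MvPolynomial.trdeg_of_isDomain, Cardinal.mk_fin, Cardinal.mk_fintype] at hle
    simp only [Cardinal.lift_natCast, Nat.cast_le] at hle
    omega
  rw [algebraicIndependent_iff] at hdep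
  push Not at hdep
  obtain ⟨P, hP, hP0⟩ := hdep
  refine ⟨P, hP0, fun z _ => ?_⟩
  simp only [hp]
  rw [← eval_aeval, hP, map_zero]

lemma isDomainOn_coordinateSubspace [Infinite k] (s : Set σ) :
    IsDomainOn (mvPolynomialFunctions σ k) {z | ∀ i ∉ s, z i = 0} := by
  classical
  have hr : IsRegularRel (mvPolynomialFunctions σ k) (mvPolynomialFunctions σ k)
      fun x z => (fun i => if i ∈ s then x i else 0) = z := by
    intro f hf
    obtain ⟨P, hP⟩ := mem_mvPolynomialFunctions.1 hf
    refine ⟨_, mem_mvPolynomialFunctions.2 ⟨MvPolynomial.aeval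
      (fun i => if i ∈ s then MvPolynomial.X i else 0) P, fun x => rfl⟩, fun x z hxz => ?_⟩
    rw [eval_aeval, hP, ← hxz]
    congr 2
    funext i
    split_ifs with hi
    · rw [MvPolynomial.eval_X]
    · rw [map_zero]
  refine hr.isDomainOn isDomainOn_mvPolynomialFunctions
    (fun x _ => ⟨_, fun i hi => if_neg hi, rfl⟩) fun z hz => ⟨z, trivial, funext fun i => ?_⟩
  split_ifs with hi
  · rfl
  · exact (hz i hi).symm

/-! ### Topologies cut out by functions -/

/-- The closed sets of `Y` are the common zero loci of the subsets of `F`. -/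
def IsZariski [TopologicalSpace Y] (F : Subalgebra k (Y → k)) : Prop :=
  ∀ C : Set Y, IsClosed C ↔ ∃ S : Set (Y → k), S ⊆ (F : Set (Y → k)) ∧ C = {y | ∀ f ∈ S, f y = 0}

namespace IsZariski

lemma of_zariskiTopology {X : Type} (R : Subalgebra ℂ (X → ℂ)) :
    @IsZariski ℂ _ X (zariskiTopology R) R := by
  intro C
  let _ := zariskiTopology R
  rw [← isOpen_compl_iff]
  change Cᶜᶜ ∈ _ ↔ _
  rw [compl_compl]
  rfl

lemma of_isInducing [TopologicalSpace X] [TopologicalSpace Y] (hG : IsZariski G) {φ : Y → X}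
    (hφ : Topology.IsInducing φ) : IsZariski (G.map (pullback φ)) := by
  intro C
  rw [hφ.isClosed_iff]
  constructor
  · rintro ⟨D, hD, rfl⟩
    obtain ⟨S, hS, rfl⟩ := (hG D).1 hD
    refine ⟨pullback φ '' S, Set.image_mono hS, ?_⟩
    ext y
    simp only [Set.mem_preimage, Set.mem_ofPred_eq, Set.forall_mem_image, pullback_apply]
  · rintro ⟨S, hS, rfl⟩
    refine ⟨{x | ∀ g ∈ {g ∈ G | pullback φ g ∈ S}, g x = 0},
      (hG _).2 ⟨_, fun g hg => hg.1, rfl⟩, ?_⟩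
    ext y
    refine ⟨fun h f hf => ?_, fun h g hg => h _ hg.2⟩
    obtain ⟨g, hg, rfl⟩ := hS hf
    exact h g ⟨hg, hf⟩

variable [TopologicalSpace Y]

lemma isClosed_zeros (hF : IsZariski F) {f : Y → k} (hf : f ∈ F) : IsClosed {y | f y = 0} :=
  (hF _).2 ⟨{f}, Set.singleton_subset_iff.2 hf, by simp⟩

lemma exists_separating (hF : IsZariski F) {C : Set Y} (hC : IsClosed C) {y : Y} (hy : y ∉ C) :
    ∃ f ∈ F, (∀ z ∈ C, f z = 0) ∧ f y ≠ 0 := by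
  obtain ⟨S, hS, rfl⟩ := (hF C).1 hC
  simp only [Set.mem_ofPred_eq, not_forall] at hy
  obtain ⟨f, hf, hfy⟩ := hy
  exact ⟨f, hS hf, fun z hz => hz f hf, hfy⟩

lemma isIrreducible_iff (hF : IsZariski F) {W : Set Y} : IsIrreducible W ↔ IsDomainOn F W := by
  refine and_congr_right fun _ => ⟨fun hW f hf g hg h => ?_, fun hW => ?_⟩
  · exact isPreirreducible_iff_isClosed_union_isClosed.1 hW _ _ (hF.isClosed_zeros hf)
      (hF.isClosed_zeros hg) fun y hy => mul_eq_zero.1 (h y hy)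
  · refine isPreirreducible_iff_isClosed_union_isClosed.2 fun C D hC hD hCD => ?_
    by_contra! hcon
    obtain ⟨a, ha, haC⟩ := Set.not_subset.1 hcon.1
    obtain ⟨b, hb, hbD⟩ := Set.not_subset.1 hcon.2
    obtain ⟨f, hf, hfC, hfa⟩ := hF.exists_separating hC haC
    obtain ⟨g, hg, hgD, hgb⟩ := hF.exists_separating hD hbD
    refine (hW f hf g hg fun y hy => ?_).elim (fun h => hfa (h a ha)) fun h => hgb (h b hb)
    exact mul_eq_zero.2 ((hCD hy).imp (hfC y) (hgD y))

lemma dimLT_closure (hF : IsZariski F) {n : ℕ} {S : Set Y} (hS : DimLT F n S) :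
    DimLT F n (closure S) := by
  intro f hf
  obtain ⟨P, hP, hPS⟩ := hS f hf
  refine ⟨P, hP, fun y hy => ?_⟩
  rw [← aeval_pi_apply]
  refine closure_minimal (fun z hz => ?_) (hF.isClosed_zeros (aeval_mem hf P)) hy
  rw [Set.mem_ofPred_eq, aeval_pi_apply, hPS z hz]

lemma dimLT_of_lt (hF : IsZariski F) {n : ℕ} {V W : TopologicalSpace.IrreducibleCloseds Y}
    (hVW : V < W) (hW : DimLT F (n + 1) (W : Set Y)) : DimLT F n (V : Set Y) := by
  obtain ⟨y, hyW, hyV⟩ := SetLike.exists_of_lt hVW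
  obtain ⟨f, hf, hfV, hfy⟩ := hF.exists_separating V.isClosed' hyV
  exact ((hF.isIrreducible_iff.1 W.isIrreducible').dimLT_zeros hW hf ⟨y, hyW, hfy⟩).mono
    fun z hz => ⟨hVW.le hz, hfV z hz⟩

lemma height_le (hF : IsZariski F) {n : ℕ} {W : TopologicalSpace.IrreducibleCloseds Y}
    (hW : DimLT F (n + 1) (W : Set Y)) : Order.height W ≤ n := by
  induction n generalizing W with
  | zero =>
    exact Order.height_le_coe_iff.2 fun V hVW =>
      absurd (hF.dimLT_of_lt hVW hW).eq_empty V.isIrreducible'.nonempty.ne_empty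
  | succ n ih =>
    exact Order.height_le_coe_iff.2 fun V hVW =>
      (ih (hF.dimLT_of_lt hVW hW)).trans_lt (Nat.cast_lt.2 n.lt_succ_self)

lemma topologicalKrullDim_le (hF : IsZariski F) {n : ℕ} (h : DimLT F (n + 1) Set.univ) :
    topologicalKrullDim Y ≤ n := by
  rw [topologicalKrullDim, Order.krullDim_eq_iSup_height]
  exact iSup_le fun W => by exact_mod_cast hF.height_le (h.mono (Set.subset_univ _))

lemma topologicalKrullDim_subtype_le (hF : IsZariski F) {n : ℕ} {S : Set Y}
    (h : DimLT F (n + 1) S) : topologicalKrullDim S ≤ n :=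
  (hF.of_isInducing Topology.IsInducing.subtypeVal).topologicalKrullDim_le <|
    (isRegularRel_pullback _).dimLT h fun y _ => ⟨y, y.2, rfl⟩

lemma topologicalKrullDim_subtype_lt (hF : IsZariski F) {n : ℕ} {S : Set Y} (h : DimLT F n S) :
    topologicalKrullDim S < n := by
  cases n with
  | zero =>
    have : IsEmpty (TopologicalSpace.IrreducibleCloseds S) :=
      ⟨fun W => W.isIrreducible'.nonempty.elim fun y _ => h.eq_empty.subset y.2⟩
    rw [topologicalKrullDim, Order.krullDim_eq_bot]
    exact WithBot.bot_lt_coe _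
  | succ n =>
    exact (hF.topologicalKrullDim_subtype_le h).trans_lt (by exact_mod_cast n.lt_succ_self)

lemma irreducibleComponents_topologicalKrullDim_eq (hF : IsZariski F) {d : ℕ} {K : Set Y}
    (hK : DimLT F d K) {ι : Type*} {I : Set ι} (hI : I.Finite) {V : ι → Set Y}
    (hVc : ∀ i ∈ I, IsClosed (V i)) (hVi : ∀ i ∈ I, IsIrreducible (V i))
    (hVd : ∀ i ∈ I, topologicalKrullDim (V i) = d)
    (hVV : ∀ i ∈ I, ∀ j ∈ I, V i ⊆ V j → V j ⊆ V i) (hcover : ∀ y, y ∈ K ∨ ∃ i ∈ I, y ∈ V i) :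
    {Z ∈ irreducibleComponents Y | topologicalKrullDim Z = d} = V '' I := by
  have hsubset {Z : Set Y} (hZ : IsIrreducible Z) : DimLT F d Z ∨ ∃ i ∈ I, Z ⊆ V i := by
    classical
    obtain ⟨C, hC, hZC⟩ := isIrreducible_iff_sUnion_isClosed.1 hZ
      (insert (closure K) (hI.toFinset.image V))
      (by simpa [Finset.forall_mem_insert] using hVc) fun y _ => by
        rcases hcover y with hy | ⟨i, hi, hy⟩
        · exact ⟨closure K, by simp, subset_closure hy⟩
        · exact ⟨V i, by simpa using Or.inr ⟨i, hi, rfl⟩, hy⟩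
    rcases Finset.mem_insert.1 hC with rfl | hC
    · exact Or.inl ((hF.dimLT_closure hK).mono hZC)
    · obtain ⟨i, hi, rfl⟩ := Finset.mem_image.1 hC
      exact Or.inr ⟨i, hI.mem_toFinset.1 hi, hZC⟩
  ext Z
  constructor
  · rintro ⟨hZ, hdim⟩
    rcases hsubset hZ.1 with h | ⟨i, hi, hZV⟩
    · exact absurd hdim (hF.topologicalKrullDim_subtype_lt h).ne
    · exact ⟨i, hi, (hZ.2 (hVi i hi) hZV).antisymm hZV⟩
  · rintro ⟨i, hi, rfl⟩
    refine ⟨⟨hVi i hi, fun W hW hVW => ?_⟩, hVd i hi⟩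
    rcases hsubset hW with h | ⟨j, hj, hWV⟩
    · exact absurd (hVd i hi) (hF.topologicalKrullDim_subtype_lt (h.mono hVW)).ne
    · exact hWV.trans (hVV i hi j hj (hVW.trans hWV))

/-- The flag of coordinate subspaces of affine space maps to a chain of irreducible sets, which the
given functions separate. -/
lemma card_le_topologicalKrullDim (hF : IsZariski F) [Infinite k] [Fintype σ]
    {r : (σ → k) → Y → Prop} (hr : IsRegularRel (mvPolynomialFunctions σ k) F r)
    (hsurj : ∀ z, ∃ y, r z y) {f : σ → Y → k} (hf : ∀ i, f i ∈ F)
    (hzero : ∀ i z y, r z y → z i = 0 → f i y = 0)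
    (hone : ∀ i z y, r z y → z i = 1 → (∀ j ≠ i, z j = 0) → f i y ≠ 0) :
    (Fintype.card σ : WithBot ℕ∞) ≤ topologicalKrullDim Y := by
  let e := Fintype.equivFin σ
  let D (m : ℕ) : Set (σ → k) := {z | ∀ i ∉ {i | (e i : ℕ) < m}, z i = 0}
  let A (m : ℕ) : Set Y := {y | ∃ z ∈ D m, r z y}
  have hA (m : ℕ) : IsIrreducible (A m) :=
    hF.isIrreducible_iff.2 <| hr.isDomainOn (isDomainOn_coordinateSubspace _)
      (fun z hz => (hsurj z).imp fun y hy => ⟨⟨z, hz, hy⟩, hy⟩) fun y hy => hy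
  have hA_mono {m m' : ℕ} (h : m ≤ m') : A m ⊆ A m' := fun y ⟨z, hz, hzy⟩ =>
    ⟨z, fun i hi => hz i fun h' => hi (h'.trans_le h), hzy⟩
  have hA_lt (m : Fin (Fintype.card σ)) : closure (A m) ⊂ closure (A (m + 1)) := by
    classical
    refine (Set.ssubset_iff_of_subset (closure_mono (hA_mono (Nat.le_succ _)))).2 ?_
    obtain ⟨y, hy⟩ := hsurj (Pi.single (e.symm m) 1)
    refine ⟨y, subset_closure ⟨Pi.single (e.symm m) 1, fun j hj => Pi.single_eq_of_ne ?_ _, hy⟩,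
      fun hyA => ?_⟩
    · rintro rfl
      simp at hj
    · refine hone (e.symm m) _ y hy (Pi.single_eq_same _ _)
        (fun j hj => Pi.single_eq_of_ne hj _) ?_
      refine closure_minimal ?_ (hF.isClosed_zeros (hf (e.symm m))) hyA
      rintro x ⟨z, hz, hzx⟩
      exact hzero _ z x hzx (hz _ (by simp))
  exact Order.LTSeries.length_le_krullDim
    (⟨Fintype.card σ, fun m => ⟨closure (A m), (hA m).closure, isClosed_closure⟩, hA_lt⟩ :
      LTSeries (TopologicalSpace.IrreducibleCloseds Y))

end IsZariski

end FunctionAlgebras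

section TwoByTwo

open Matrix

section CommRing

variable {R S : Type*} [CommRing R] [CommRing S]

/-- The matrix of rank at most one and trace `τ` with image spanned by `(1 + c u, u)`. The values
`c = 0` and `c = 1` are two charts, which together contain every singular `2 × 2` matrix over a
field. -/
def rankOne (τ c u v : R) : Matrix (Fin 2) (Fin 2) R :=
  vecMulVec ![1 + c * u, u] ![τ - u * v, (1 + c * u) * v - c * τ]

lemma det_rankOne (τ c u v : R) : (rankOne τ c u v).det = 0 := det_vecMulVec _ _

lemma trace_rankOne (τ c u v : R) : (rankOne τ c u v).trace = τ := by
  simp only [rankOne, trace_vecMulVec, dotProduct, Fin.sum_univ_two, cons_val_zero, cons_val_one]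
  ring

lemma map_rankOne (φ : R →+* S) (τ c u v : R) :
    (rankOne τ c u v).map φ = rankOne (φ τ) (φ c) (φ u) (φ v) := by
  ext i j
  fin_cases i <;> fin_cases j <;> simp [rankOne, vecMulVec]

lemma smul_rankOne_zero (x c u v : R) : x • rankOne 0 c u v = rankOne 0 c u (x * v) := by
  ext i j
  fin_cases i <;> fin_cases j <;> simp [rankOne, vecMulVec] <;> ring

lemma mul_self_of_det_eq_zero {C : Matrix (Fin 2) (Fin 2) R} (hC : C.det = 0) :
    C * C = C.trace • C := by
  rw [det_fin_two] at hC
  ext i j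
  fin_cases i <;> fin_cases j <;> simp [mul_apply, Fin.sum_univ_two, trace_fin_two] <;> grind

lemma isIdempotentElem_of_det_eq_zero_of_trace_eq_one {C : Matrix (Fin 2) (Fin 2) R}
    (hdet : C.det = 0) (htr : C.trace = 1) : IsIdempotentElem C := by
  rw [IsIdempotentElem, mul_self_of_det_eq_zero hdet, htr, one_smul]

lemma det_smul_one_add_smul {C : Matrix (Fin 2) (Fin 2) R} (hC : C.det = 0) (α x : R) :
    (α • 1 + x • C).det = α * (α + x * C.trace) := by
  rw [det_fin_two] at hC
  simp only [det_fin_two, trace_fin_two, Matrix.add_apply, Matrix.smul_apply, one_apply_eq,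
    one_apply_ne zero_ne_one, one_apply_ne one_ne_zero, smul_eq_mul]
  linear_combination x ^ 2 * hC

lemma det_sub_smul_one (A : Matrix (Fin 2) (Fin 2) R) (α : R) :
    (A - α • 1).det = A.det - α * (A.trace - α) := by
  simp only [det_fin_two, trace_fin_two, Matrix.sub_apply, Matrix.smul_apply, one_apply_eq,
    one_apply_ne zero_ne_one, one_apply_ne one_ne_zero, smul_eq_mul]
  ring

lemma trace_smul_one_add_smul (C : Matrix (Fin 2) (Fin 2) R) (α x : R) :
    (α • 1 + x • C).trace = 2 * α + x * C.trace := by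
  rw [trace_add, trace_smul, trace_smul, trace_one, Fintype.card_fin, smul_eq_mul, smul_eq_mul,
    Nat.cast_ofNat, mul_comm α]

lemma trace_sub_smul_one (A : Matrix (Fin 2) (Fin 2) R) (α : R) :
    (A - α • 1).trace = A.trace - 2 * α := by
  rw [trace_sub, trace_smul, trace_one, Fintype.card_fin, smul_eq_mul, Nat.cast_ofNat, mul_comm α]

lemma smul_one_add_smul_pow_of_isIdempotentElem {A : Type*} [Ring A] [Algebra R A] {C : A}
    (hC : IsIdempotentElem C) (α x : R) (n : ℕ) :
    (α • 1 + x • C) ^ n = α ^ n • 1 + ((α + x) ^ n - α ^ n) • C := by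
  induction n with
  | zero => simp
  | succ n ih =>
    rw [pow_succ, ih]
    simp only [add_mul, mul_add, smul_mul_smul_comm, hC.eq, mul_one, one_mul]
    module

lemma smul_one_add_smul_pow_of_mul_self_eq_zero {A : Type*} [Ring A] [Algebra R A] {C : A}
    (hC : C * C = 0) (α x : R) (n : ℕ) :
    (α • 1 + x • C) ^ (n + 1) = α ^ (n + 1) • 1 + ((n + 1) * α ^ n * x) • C := by
  induction n with
  | zero => simp
  | succ n ih =>
    rw [pow_succ, ih]
    simp only [add_mul, mul_add, smul_mul_smul_comm, hC, mul_one, one_mul]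
    push_cast
    module

end CommRing

section Field

variable {K : Type*} [Field K]

lemma exists_rankOne_eq {C : Matrix (Fin 2) (Fin 2) K} (hC : C.det = 0) :
    ∃ c u v : K, (c = 0 ∨ c = 1) ∧ C = rankOne C.trace c u v := by
  rw [det_fin_two] at hC
  by_cases hb : C 0 1 = 0
  · by_cases ha : C 0 0 = 0
    · refine ⟨1, -1, -(C 1 1 + C 1 0), Or.inr rfl, ?_⟩
      ext i j
      fin_cases i <;> fin_cases j <;> simp [rankOne, vecMulVec, trace_fin_two, ha, hb]
    · have hd : C 1 1 = 0 := by simpa [hb, ha] using hC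
      refine ⟨0, C 1 0 / C 0 0, 0, Or.inl rfl, ?_⟩
      ext i j
      fin_cases i <;> fin_cases j <;> simp [rankOne, vecMulVec, trace_fin_two, hb, hd, ha]
  · refine ⟨0, C 1 1 / C 0 1, C 0 1, Or.inl rfl, ?_⟩
    ext i j
    fin_cases i <;> fin_cases j <;> simp [rankOne, vecMulVec, trace_fin_two, hb]
    field_simp
    linear_combination -hC

lemma exists_eq_smul_one_add_of_trace_of_det {A : Matrix (Fin 2) (Fin 2) K} {α β : K}
    (htr : A.trace = α + β) (hdet : A.det = α * β) (hne : α ≠ β) :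
    ∃ C : Matrix (Fin 2) (Fin 2) K, C.det = 0 ∧ C.trace = 1 ∧ A = α • 1 + (β - α) • C := by
  have hsub : β - α ≠ 0 := sub_ne_zero.2 hne.symm
  refine ⟨(β - α)⁻¹ • (A - α • 1), ?_, ?_, ?_⟩
  · rw [det_smul, det_sub_smul_one, htr, hdet, add_sub_cancel_left, sub_self, mul_zero]
  · rw [trace_smul, trace_sub_smul_one, htr, smul_eq_mul, inv_mul_eq_one₀ hsub]
    ring
  · rw [smul_inv_smul₀ hsub, add_sub_cancel]

lemma exists_eq_smul_one_add_smul [IsAlgClosed K] (A : Matrix (Fin 2) (Fin 2) K) :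
    ∃ (α x : K) (C : Matrix (Fin 2) (Fin 2) K),
      C.det = 0 ∧ (C.trace = 0 ∨ C.trace = 1) ∧ A = α • 1 + x • C := by
  obtain ⟨α, hα⟩ : ∃ α : K, α * (A.trace - α) = A.det := by
    obtain ⟨α, hα⟩ := IsAlgClosed.exists_root A.charpoly (by simp)
    rw [charpoly_fin_two, Polynomial.IsRoot.def] at hα
    simp only [Polynomial.eval_add, Polynomial.eval_sub, Polynomial.eval_mul,
      Polynomial.eval_pow, Polynomial.eval_X, Polynomial.eval_C] at hα
    exact ⟨α, by linear_combination -hα⟩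
  by_cases hne : α = A.trace - α
  · refine ⟨α, 1, A - α • 1, ?_, Or.inl ?_, by rw [one_smul, add_sub_cancel]⟩
    · rw [det_sub_smul_one, hα, sub_self]
    · rw [trace_sub_smul_one, sub_eq_zero, two_mul]
      exact eq_sub_iff_add_eq.1 hne ▸ rfl
  · obtain ⟨C, hdet, htr, hA⟩ :=
      exists_eq_smul_one_add_of_trace_of_det (add_sub_cancel α A.trace).symm hα.symm hne
    exact ⟨α, _, C, hdet, Or.inr htr, hA⟩

lemma exists_eq_smul_one_add_smul_of_commute {A B : Matrix (Fin 2) (Fin 2) K} (h : Commute A B)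
    (hA : ∀ a : K, A ≠ a • 1) : ∃ a b : K, B = a • 1 + b • A := by
  have h00 := congrFun (congrFun h.eq 0) 0
  have h01 := congrFun (congrFun h.eq 0) 1
  have h10 := congrFun (congrFun h.eq 1) 0
  simp only [mul_apply, Fin.sum_univ_two] at h00 h01 h10
  suffices ∃ b, B 0 1 = b * A 0 1 ∧ B 1 0 = b * A 1 0 ∧ B 0 0 - B 1 1 = b * (A 0 0 - A 1 1) by
    obtain ⟨b, h01, h10, hdiag⟩ := this
    refine ⟨B 0 0 - b * A 0 0, b, ?_⟩
    ext i j
    fin_cases i <;> fin_cases j <;> simp [h01, h10]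
    linear_combination -hdiag
  by_cases hA01 : A 0 1 = 0
  · by_cases hA10 : A 1 0 = 0
    · by_cases hAdiag : A 0 0 - A 1 1 = 0
      · refine (hA (A 0 0) ?_).elim
        ext i j
        fin_cases i <;> fin_cases j <;> simp [hA01, hA10]
        linear_combination -hAdiag
      · exact ⟨(B 0 0 - B 1 1) / (A 0 0 - A 1 1), by grind, by grind, by grind⟩
    · exact ⟨B 1 0 / A 1 0, by grind, by grind, by grind⟩
  · exact ⟨B 0 1 / A 0 1, by grind, by grind, by grind⟩

/-- The common matrix `C` is of square zero or idempotent, by Cayley–Hamilton. -/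
lemma exists_common_of_commute [IsAlgClosed K] {A B : Matrix (Fin 2) (Fin 2) K}
    (h : Commute A B) : ∃ (α x β y : K) (C : Matrix (Fin 2) (Fin 2) K),
      C.det = 0 ∧ (C.trace = 0 ∨ C.trace = 1) ∧ A = α • 1 + x • C ∧ B = β • 1 + y • C := by
  by_cases hA : ∃ a : K, A = a • 1
  · obtain ⟨a, rfl⟩ := hA
    obtain ⟨β, y, C, hdet, htr, hB⟩ := exists_eq_smul_one_add_smul B
    exact ⟨a, 0, β, y, C, hdet, htr, by rw [zero_smul, add_zero], hB⟩
  · push Not at hA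
    obtain ⟨a, b, hB⟩ := exists_eq_smul_one_add_smul_of_commute h hA
    obtain ⟨α, x, C, hdet, htr, hA⟩ := exists_eq_smul_one_add_smul A
    refine ⟨α, x, a + b * α, b * x, C, hdet, htr, hA, ?_⟩
    rw [hB, hA]
    module

end Field

end TwoByTwo

section RotationTraces

open Matrix

/-- The squared traces of the nontrivial elements of order dividing `p` in `PSL(2, ℂ)`, where `ζ`
is the ratio of the two eigenvalues. -/
noncomputable def rotationTraces (p : ℕ) : Finset ℂ :=
  ((Polynomial.nthRootsFinset p (1 : ℂ)).erase 1).image fun ζ => ζ + 2 + ζ⁻¹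

lemma mem_rotationTraces {p : ℕ} (hp : 0 < p) {τ : ℂ} :
    τ ∈ rotationTraces p ↔ ∃ w : ℂ, (w ^ 2) ^ p = 1 ∧ w ^ 2 ≠ 1 ∧ (w + w⁻¹) ^ 2 = τ := by
  have hsq {w : ℂ} (hw : (w ^ 2) ^ p = 1) : (w + w⁻¹) ^ 2 = w ^ 2 + 2 + (w ^ 2)⁻¹ := by
    have hw0 : w ≠ 0 := by
      rintro rfl
      simp [hp.ne'] at hw
    field_simp
    ring
  simp only [rotationTraces, Finset.mem_image, Finset.mem_erase, Polynomial.mem_nthRootsFinset hp]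
  constructor
  · rintro ⟨ζ, ⟨hζ1, hζ⟩, rfl⟩
    obtain ⟨w, rfl⟩ := IsAlgClosed.exists_pow_nat_eq ζ two_pos
    exact ⟨w, hζ, hζ1, hsq hζ⟩
  · rintro ⟨w, hw, hw1, rfl⟩
    exact ⟨w ^ 2, ⟨hw1, hw⟩, (hsq hw).symm⟩

lemma add_inv_eq_add_inv_iff {K : Type*} [Field K] {x y : K} (hx : x ≠ 0) (hy : y ≠ 0) :
    x + x⁻¹ = y + y⁻¹ ↔ x = y ∨ x * y = 1 := by
  have h : (x - y) * (x * y - 1) = x * y * (x + x⁻¹ - (y + y⁻¹)) := by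
    field_simp
    ring
  rw [← sub_eq_zero, ← sub_eq_zero (a := x), ← sub_eq_zero (a := x * y), ← mul_eq_zero, h,
    mul_eq_zero, or_iff_right (mul_ne_zero hx hy)]

lemma rotationTraces_eq_image {p : ℕ} (hp : 0 < p) {ξ : ℂ} (hξ : IsPrimitiveRoot ξ p) :
    rotationTraces p = (Finset.Icc 1 (p / 2)).image fun j => ξ ^ j + 2 + (ξ ^ j)⁻¹ := by
  ext τ
  simp only [rotationTraces, Finset.mem_image, Finset.mem_erase,
    Polynomial.mem_nthRootsFinset hp, Finset.mem_Icc]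
  constructor
  · rintro ⟨ζ, ⟨hζ1, hζ⟩, rfl⟩
    have : NeZero p := ⟨hp.ne'⟩
    obtain ⟨j, hj, rfl⟩ := hξ.eq_pow_of_pow_eq_one hζ
    have hj0 : j ≠ 0 := fun h => hζ1 (by rw [h, pow_zero])
    rcases le_or_gt j (p / 2) with hjp | hjp
    · exact ⟨j, ⟨by omega, hjp⟩, rfl⟩
    · have hinv : ξ ^ (p - j) = (ξ ^ j)⁻¹ := eq_inv_of_mul_eq_one_left <| by
        rw [← pow_add, Nat.sub_add_cancel hj.le, hξ.pow_eq_one]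
      exact ⟨p - j, ⟨by omega, by omega⟩, by rw [hinv, inv_inv]; ring⟩
  · rintro ⟨j, hj, rfl⟩
    refine ⟨ξ ^ j, ⟨fun h => ?_, ?_⟩, rfl⟩
    · have := Nat.le_of_dvd (by omega) ((hξ.pow_eq_one_iff_dvd j).1 h)
      omega
    · rw [← pow_mul, mul_comm, pow_mul, hξ.pow_eq_one, one_pow]

lemma card_rotationTraces (p : ℕ) : (rotationTraces p).card = p / 2 := by
  rcases p.eq_zero_or_pos with rfl | hp
  · simp [rotationTraces]
  obtain ⟨ξ, hξ⟩ : ∃ ξ : ℂ, IsPrimitiveRoot ξ p := ⟨_, Complex.isPrimitiveRoot_exp p hp.ne'⟩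
  have hξ0 (j : ℕ) : ξ ^ j ≠ 0 := pow_ne_zero j (hξ.ne_zero hp.ne')
  rw [rotationTraces_eq_image hp hξ, Finset.card_image_of_injOn, Nat.card_Icc, Nat.add_sub_cancel]
  intro i hi j hj h
  rw [Finset.mem_coe, Finset.mem_Icc] at hi hj
  have h' : ξ ^ i + (ξ ^ i)⁻¹ = ξ ^ j + (ξ ^ j)⁻¹ := by linear_combination h
  rcases (add_inv_eq_add_inv_iff (hξ0 i) (hξ0 j)).1 h' with h' | h'
  · exact hξ.pow_inj (by omega) (by omega) h'
  · rw [← pow_add, hξ.pow_eq_one_iff_dvd] at h'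
    have := Nat.le_of_dvd (by omega) h'
    omega

/-- For `C` of determinant zero and trace one, the matrix with eigenvalue `w` on the image and `w⁻¹`
on the kernel of `C`. -/
noncomputable def toralMatrix (w : ℂ) (C : Matrix (Fin 2) (Fin 2) ℂ) : Matrix (Fin 2) (Fin 2) ℂ :=
  w⁻¹ • 1 + (w - w⁻¹) • C

variable {p : ℕ} {w : ℂ} {A C : Matrix (Fin 2) (Fin 2) ℂ}

lemma det_toralMatrix (hdet : C.det = 0) (htr : C.trace = 1) (hw : w ≠ 0) :
    (toralMatrix w C).det = 1 := by
  rw [toralMatrix, det_smul_one_add_smul hdet, htr, mul_one, add_sub_cancel, inv_mul_cancel₀ hw]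

lemma trace_toralMatrix (htr : C.trace = 1) : (toralMatrix w C).trace = w + w⁻¹ := by
  rw [toralMatrix, trace_smul_one_add_smul, htr]
  ring

lemma toralMatrix_zero (C : Matrix (Fin 2) (Fin 2) ℂ) : toralMatrix 0 C = 0 := by
  rw [toralMatrix, _root_.inv_zero, sub_zero, zero_smul, zero_smul, add_zero]

lemma toralMatrix_pow (hC : IsIdempotentElem C) (n : ℕ) :
    toralMatrix w C ^ n = toralMatrix (w ^ n) C := by
  rw [toralMatrix, smul_one_add_smul_pow_of_isIdempotentElem hC, add_sub_cancel, inv_pow,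
    toralMatrix]

lemma toralMatrix_pow_eq_one_or (hC : IsIdempotentElem C) (hw : (w ^ 2) ^ p = 1) :
    toralMatrix w C ^ p = 1 ∨ toralMatrix w C ^ p = -1 := by
  rw [← pow_mul, mul_comm, pow_mul, sq_eq_one_iff] at hw
  rw [toralMatrix_pow hC, toralMatrix]
  rcases hw with h | h <;> simp [h]

lemma toralMatrix_mul_self (hC : IsIdempotentElem C) : toralMatrix w C * C = w • C := by
  rw [toralMatrix, add_mul, smul_mul_assoc, smul_mul_assoc, one_mul, hC.eq]
  module

lemma smul_one_add_smul_eq_toralMatrix (hdet : C.det = 0) (htr : C.trace = 1) {α x : ℂ}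
    (h : (α • 1 + x • C).det = 1) : α • 1 + x • C = toralMatrix (α + x) C := by
  rw [det_smul_one_add_smul hdet, htr, mul_one] at h
  rw [toralMatrix, ← eq_inv_of_mul_eq_one_left h, add_sub_cancel_left]

lemma exists_eq_toralMatrix (hdet : A.det = 1) (hw0 : w ≠ 0) (hw : w ^ 2 ≠ 1)
    (htr : A.trace = w + w⁻¹) : ∃ C, C.det = 0 ∧ C.trace = 1 ∧ A = toralMatrix w C := by
  refine exists_eq_smul_one_add_of_trace_of_det (by rw [htr, add_comm])
    (by rw [hdet, inv_mul_cancel₀ hw0]) fun h => hw ?_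
  rw [sq]
  nth_rewrite 1 [← h]
  exact inv_mul_cancel₀ hw0

lemma pow_ne_smul_one_of_mul_self_eq_zero (hp : 0 < p) (hC : C * C = 0)
    (htr : C.trace = 0) {α x : ℂ} (hα : α ≠ 0) (hx : x • C ≠ 0) (ε : ℂ) :
    (α • 1 + x • C) ^ p ≠ ε • 1 := by
  obtain ⟨q, rfl⟩ := Nat.exists_eq_succ_of_ne_zero hp.ne'
  intro h
  rw [Nat.succ_eq_add_one, smul_one_add_smul_pow_of_mul_self_eq_zero hC] at h
  have hε : α ^ (q + 1) = ε := by simpa [htr] using congrArg trace h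
  rw [hε, add_eq_left, mul_smul, smul_eq_zero] at h
  exact h.elim (mul_ne_zero (Nat.cast_add_one_ne_zero q) (pow_ne_zero q hα)) hx

lemma trace_sq_mem_rotationTraces (hp : 0 < p) (hdet : A.det = 1) (hpow : A ^ p = 1 ∨ A ^ p = -1)
    (hA : ∀ a : ℂ, A ≠ a • 1) : A.trace ^ 2 ∈ rotationTraces p := by
  obtain ⟨ε, hε, hpow⟩ : ∃ ε : ℂ, ε ^ 2 = 1 ∧ A ^ p = ε • 1 :=
    hpow.elim (fun h => ⟨1, one_pow 2, by rw [h, one_smul]⟩)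
      fun h => ⟨-1, neg_one_sq, by rw [h, neg_smul, one_smul]⟩
  obtain ⟨α, x, C, hC, htr, rfl⟩ := exists_eq_smul_one_add_smul A
  have hx : x • C ≠ 0 := fun hx => hA α (by rw [hx, add_zero])
  rcases htr with htr | htr
  · have hCC : C * C = 0 := by rw [mul_self_of_det_eq_zero hC, htr, zero_smul]
    have hα : α ≠ 0 := left_ne_zero_of_mul_eq_one ((det_smul_one_add_smul hC α x).symm.trans hdet)
    exact absurd hpow (pow_ne_smul_one_of_mul_self_eq_zero hp hCC htr hα hx ε)
  have hCC := isIdempotentElem_of_det_eq_zero_of_trace_eq_one hC htr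
  rw [smul_one_add_smul_eq_toralMatrix hC htr hdet] at hpow hA ⊢
  rw [trace_toralMatrix htr]
  refine (mem_rotationTraces hp).2 ⟨α + x, ?_, fun h => ?_, rfl⟩
  · have heigen : (α + x) ^ p = ε := by
      have h := congrArg (fun N => (N * C).trace) hpow
      simpa only [toralMatrix_pow hCC, toralMatrix_mul_self hCC, smul_mul_assoc, one_mul,
        trace_smul, htr, smul_eq_mul, mul_one] using h
    rw [← pow_mul, mul_comm, pow_mul, heigen, hε]
  · refine hA (α + x) ?_
    rw [toralMatrix, inv_eq_of_mul_eq_one_left ((sq _).symm.trans h), sub_self, zero_smul, add_zero]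

end RotationTraces

section RepVariety

open Matrix

lemma specialLinearGroup_mk_eq_iff (a b : SpecialLinearGroup (Fin 2) ℂ) :
    (QuotientGroup.mk a : PSL2C) = QuotientGroup.mk b ↔ a.1 = b.1 ∨ a.1 = -b.1 := by
  rw [eq_comm, QuotientGroup.eq, Matrix.SpecialLinearGroup.mem_center_iff]
  constructor
  · rintro ⟨r, hr, h⟩
    have hab : a.1 = r • b.1 := by
      rw [← mul_inv_cancel_left b a, Matrix.SpecialLinearGroup.coe_mul, ← h, scalar_apply,
        ← smul_one_eq_diagonal, mul_smul_comm, mul_one]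
    rw [Fintype.card_fin, sq_eq_one_iff] at hr
    rcases hr with rfl | rfl
    · exact Or.inl (by rw [hab, one_smul])
    · exact Or.inr (by rw [hab, neg_smul, one_smul])
  · rintro (h | h)
    · rw [show a = b from Subtype.ext h, inv_mul_cancel]
      exact ⟨1, one_pow _, by rw [map_one, Matrix.SpecialLinearGroup.coe_one]⟩
    · rw [show a = -b from Subtype.ext (by rw [h, Matrix.SpecialLinearGroup.coe_neg]), mul_neg,
        inv_mul_cancel]
      exact ⟨-1, by rw [Fintype.card_fin, neg_one_sq], by
        rw [map_neg, map_one, Matrix.SpecialLinearGroup.coe_neg, Matrix.SpecialLinearGroup.coe_one]⟩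

lemma projPow_eq_iff {n : ℕ} (g h : Fin n → SpecialLinearGroup (Fin 2) ℂ) :
    projPow n g = projPow n h ↔ ∀ i, (g i).1 = (h i).1 ∨ (g i).1 = -(h i).1 :=
  funext_iff.trans <| forall_congr' fun _ => specialLinearGroup_mk_eq_iff _ _

lemma projPow_surjective (n : ℕ) : Function.Surjective (projPow n) := by
  intro q
  choose g hg using fun i => QuotientGroup.mk_surjective (q i)
  exact ⟨g, funext hg⟩

variable {G : Type} [Group G] {n : ℕ} (s : Fin n → G)

/-- The coordinate algebra of the representation variety, made of the restrictions of the regular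
functions on `PSL(2, ℂ)ⁿ`. -/
noncomputable def repFunctions : Subalgebra ℂ (RepVariety s → ℂ) :=
  (regularFunctions n).map (pullback (RepVariety.toPow s))

lemma isZariski_repFunctions : IsZariski (repFunctions s) :=
  (IsZariski.of_zariskiTopology (regularFunctions n)).of_isInducing ⟨rfl⟩

variable {s}

/-- The matrices `M i` have determinant one, and their classes in `PSL(2, ℂ)` are the values of the
representation `ρ` at the generators `s i`. -/
def IsLift (M : Fin n → Matrix (Fin 2) (Fin 2) ℂ) (ρ : RepVariety s) : Prop :=
  ∃ g : Fin n → SpecialLinearGroup (Fin 2) ℂ,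
    (∀ i, (g i).1 = M i) ∧ RepVariety.toPow s ρ = projPow n g

lemma exists_isLift (ρ : RepVariety s) : ∃ M, IsLift M ρ := by
  obtain ⟨g, hg⟩ := projPow_surjective n (RepVariety.toPow s ρ)
  exact ⟨fun i => (g i).1, g, fun i => rfl, hg.symm⟩

namespace IsLift

variable {M M' : Fin n → Matrix (Fin 2) (Fin 2) ℂ} {ρ : RepVariety s}

lemma det_eq_one (h : IsLift M ρ) (i : Fin n) : (M i).det = 1 := by
  obtain ⟨g, hg, -⟩ := h
  rw [← hg i]
  exact (g i).2

lemma isLift_iff (h : IsLift M ρ) : IsLift M' ρ ↔ ∀ i, M' i = M i ∨ M' i = -M i := by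
  constructor
  · obtain ⟨g, hg, hρ⟩ := h
    rintro ⟨g', hg', hρ'⟩ i
    rw [← hg, ← hg']
    exact (projPow_eq_iff g' g).1 (hρ'.symm.trans hρ) i
  · intro h'
    have hdet (i : Fin n) : (M' i).det = 1 := by
      rcases h' i with h' | h' <;> rw [h']
      · exact h.det_eq_one i
      · rw [det_neg, h.det_eq_one i, Fintype.card_fin, neg_one_sq, one_mul]
    obtain ⟨g, hg, hρ⟩ := h
    refine ⟨fun i => ⟨M' i, hdet i⟩, fun i => rfl, hρ.trans ((projPow_eq_iff _ _).2 fun i => ?_)⟩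
    rw [hg i]
    exact (h' i).imp Eq.symm fun h => (neg_eq_iff_eq_neg.2 h).symm

end IsLift

lemma isRegularRel_isLift {σ : Type*} (E : Fin n → Matrix (Fin 2) (Fin 2) (MvPolynomial σ ℂ)) :
    IsRegularRel (mvPolynomialFunctions σ ℂ) (repFunctions s)
      fun z ρ => IsLift (fun i => (E i).map (MvPolynomial.eval z)) ρ := by
  rintro _ ⟨f, ⟨P, hP⟩, rfl⟩
  refine ⟨_, mem_mvPolynomialFunctions.2
    ⟨MvPolynomial.aeval (fun k : Fin n × Fin 2 × Fin 2 => E k.1 k.2.1 k.2.2) P, fun z => rfl⟩, ?_⟩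
  rintro z ρ ⟨g, hg, hρ⟩
  rw [eval_aeval]
  simp only [← Matrix.map_apply (f := MvPolynomial.eval z), ← hg]
  exact (congrArg f hρ).trans (hP g)

lemma isRegularRel_chart {σ : Type*} (α x τ c u v : Fin n → MvPolynomial σ ℂ) :
    IsRegularRel (mvPolynomialFunctions σ ℂ) (repFunctions s) fun z ρ =>
      IsLift (fun i => MvPolynomial.eval z (α i) • 1 + MvPolynomial.eval z (x i) •
        rankOne (MvPolynomial.eval z (τ i)) (MvPolynomial.eval z (c i))
          (MvPolynomial.eval z (u i)) (MvPolynomial.eval z (v i))) ρ := by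
  have h := isRegularRel_isLift (s := s)
    fun i => α i • 1 + x i • rankOne (τ i) (c i) (u i) (v i)
  simpa only [Matrix.map_add _ (map_add _), Matrix.map_smul' _ _ _ (map_mul _),
    Matrix.map_one _ (map_zero _) (map_one _), map_rankOne] using h

lemma exists_repFunction_entry_mul (i : Fin n) (a b c d : Fin 2) :
    ∃ f ∈ repFunctions s, ∀ M ρ, IsLift M ρ → f ρ = M i a b * M i c d := by
  choose lift hlift using projPow_surjective n
  have hlift_mul (g : Fin n → SpecialLinearGroup (Fin 2) ℂ) :
      (lift (projPow n g) i).1 a b * (lift (projPow n g) i).1 c d =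
        (g i).1 a b * (g i).1 c d := by
    rcases (projPow_eq_iff _ _).1 (hlift (projPow n g)) i with h | h <;> rw [h]
    simp only [Matrix.neg_apply, neg_mul_neg]
  refine ⟨_, ⟨fun q => (lift q i).1 a b * (lift q i).1 c d,
    ⟨MvPolynomial.X (i, a, b) * MvPolynomial.X (i, c, d), fun g => ?_⟩, rfl⟩, ?_⟩
  · rw [map_mul, MvPolynomial.eval_X, MvPolynomial.eval_X]
    exact hlift_mul g
  · rintro M ρ ⟨g, hg, hρ⟩
    change (lift (RepVariety.toPow s ρ) i).1 a b * (lift (RepVariety.toPow s ρ) i).1 c d = _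
    rw [hρ, hlift_mul, hg]

lemma exists_repFunction_trace_sq (i : Fin n) :
    ∃ f ∈ repFunctions s, ∀ M ρ, IsLift M ρ → f ρ = (M i).trace ^ 2 := by
  obtain ⟨f, hf, hfM⟩ := exists_repFunction_entry_mul (s := s) i 0 0 0 0
  obtain ⟨g, hg, hgM⟩ := exists_repFunction_entry_mul (s := s) i 0 0 1 1
  obtain ⟨h, hh, hhM⟩ := exists_repFunction_entry_mul (s := s) i 1 1 1 1
  refine ⟨f + (2 : ℂ) • g + h, add_mem (add_mem hf (Subalgebra.smul_mem _ hg _)) hh,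
    fun M ρ hM => ?_⟩
  simp only [Pi.add_apply, Pi.smul_apply, smul_eq_mul, hfM M ρ hM, hgM M ρ hM, hhM M ρ hM,
    trace_fin_two]
  ring

variable (s) in
/-- The representations sending each generator `s i` to an element of squared trace `τ i`. The
square makes the trace well defined on `PSL(2, ℂ)`. -/
def traceReps (τ : Fin n → ℂ) : Set (RepVariety s) :=
  {ρ | ∃ M, IsLift M ρ ∧ ∀ i, (M i).trace ^ 2 = τ i}

variable {τ : Fin n → ℂ} {M : Fin n → Matrix (Fin 2) (Fin 2) ℂ} {ρ : RepVariety s}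

lemma mem_traceReps_iff (h : IsLift M ρ) : ρ ∈ traceReps s τ ↔ ∀ i, (M i).trace ^ 2 = τ i := by
  refine ⟨fun ⟨M', h', hτ⟩ i => ?_, fun hτ => ⟨M, h, hτ⟩⟩
  rw [← hτ i]
  rcases h.isLift_iff.1 h' i with hi | hi <;> rw [hi]
  rw [trace_neg, neg_sq]

lemma eq_of_mem_traceReps {τ' : Fin n → ℂ} (h : ρ ∈ traceReps s τ) (h' : ρ ∈ traceReps s τ') :
    τ = τ' := by
  obtain ⟨M, hM⟩ := exists_isLift ρ
  exact funext fun i =>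
    ((mem_traceReps_iff hM).1 h i).symm.trans ((mem_traceReps_iff hM).1 h' i)

lemma exists_isLift_trace_eq {θ : Fin n → ℂ} (h : ρ ∈ traceReps s τ) (hθ : ∀ i, θ i ^ 2 = τ i) :
    ∃ M, IsLift M ρ ∧ ∀ i, (M i).trace = θ i := by
  obtain ⟨M, hM, hτ⟩ := h
  have hsign (i : Fin n) : ∃ N, (N = M i ∨ N = -M i) ∧ N.trace = θ i := by
    rcases sq_eq_sq_iff_eq_or_eq_neg.1 ((hτ i).trans (hθ i).symm) with h | h
    · exact ⟨M i, Or.inl rfl, h⟩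
    · exact ⟨-M i, Or.inr rfl, by rw [trace_neg, h, neg_neg]⟩
  choose N hN htr using hsign
  exact ⟨N, hM.isLift_iff.2 hN, htr⟩

variable (s) in
lemma isClosed_traceReps (τ : Fin n → ℂ) : IsClosed (traceReps s τ) := by
  choose f hf hfM using exists_repFunction_trace_sq (s := s)
  have hzeros : traceReps s τ = ⋂ i, {ρ | (f i - algebraMap ℂ _ (τ i)) ρ = 0} := by
    ext ρ
    obtain ⟨M, hM⟩ := exists_isLift ρ
    simp only [mem_traceReps_iff hM, Set.mem_iInter, Set.mem_ofPred_eq, Pi.sub_apply,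
      Pi.algebraMap_apply, Algebra.algebraMap_self_apply, hfM _ M ρ hM, sub_eq_zero]
  rw [hzeros]
  exact isClosed_iInter fun i => (isZariski_repFunctions s).isClosed_zeros <|
    sub_mem (hf i) (Subalgebra.algebraMap_mem _ _)

end RepVariety

section TorusGroup

open Matrix

variable {p t : ℕ} {M : Fin 2 → Matrix (Fin 2) (Fin 2) ℂ}

lemma torusGroupGen_pow_eq (p t : ℕ) : torusGroupGen p t 0 ^ p = torusGroupGen p t 1 ^ t := by
  have h := PresentedGroup.one_of_mem (rels := {FreeGroup.of 0 ^ p * (FreeGroup.of 1 ^ t)⁻¹})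
    (Set.mem_singleton (FreeGroup.of (0 : Fin 2) ^ p * (FreeGroup.of 1 ^ t)⁻¹))
  rwa [map_mul, map_inv, map_pow, map_pow, mul_inv_eq_one] at h

lemma exists_isLift_of_pow (hdet : ∀ i, (M i).det = 1)
    (hpow : M 0 ^ p = M 1 ^ t ∨ M 0 ^ p = -M 1 ^ t) :
    ∃ ρ : RepVariety (torusGroupGen p t), IsLift M ρ := by
  let g : Fin 2 → SpecialLinearGroup (Fin 2) ℂ := fun i => ⟨M i, hdet i⟩
  have hrel : ∀ r ∈ ({FreeGroup.of 0 ^ p * (FreeGroup.of 1 ^ t)⁻¹} : Set (FreeGroup (Fin 2))),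
      FreeGroup.lift (fun i => (QuotientGroup.mk (g i) : PSL2C)) r = 1 := by
    rintro r rfl
    rw [map_mul, map_inv, map_pow, map_pow, FreeGroup.lift_apply_of, FreeGroup.lift_apply_of,
      mul_inv_eq_one]
    exact (specialLinearGroup_mk_eq_iff (g 0 ^ p) (g 1 ^ t)).2 (by
      simpa only [Matrix.SpecialLinearGroup.coe_pow] using hpow)
  exact ⟨PresentedGroup.toGroup hrel, g, fun i => rfl,
    funext fun i => PresentedGroup.toGroup.of hrel⟩

lemma IsLift.pow_eq {ρ : RepVariety (torusGroupGen p t)} (h : IsLift M ρ) :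
    M 0 ^ p = M 1 ^ t ∨ M 0 ^ p = -M 1 ^ t := by
  obtain ⟨g, hg, hρ⟩ := h
  have hmk : (QuotientGroup.mk (g 0 ^ p) : PSL2C) = QuotientGroup.mk (g 1 ^ t) := by
    change projPow 2 g 0 ^ p = projPow 2 g 1 ^ t
    rw [← hρ]
    have hgen := congrArg (show torusGroup p t →* PSL2C from ρ) (torusGroupGen_pow_eq p t)
    exact (map_pow _ _ _).symm.trans (hgen.trans (map_pow _ _ _))
  simpa only [Matrix.SpecialLinearGroup.coe_pow, hg] using (specialLinearGroup_mk_eq_iff _ _).1 hmk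

end TorusGroup

section CommutingReps

open Matrix

variable {G : Type} [Group G] {n : ℕ} (s : Fin n → G)

/-- The representations with values in the classes of `1 + x • C` for a single nilpotent `C`. -/
def unipotentReps : Set (RepVariety s) :=
  {ρ | ∃ C : Matrix (Fin 2) (Fin 2) ℂ, C.det = 0 ∧ C.trace = 0 ∧
    ∃ x : Fin n → ℂ, IsLift (fun i => 1 + x i • C) ρ}

/-- The representations with values in a maximal torus, the one determined by `C`. -/
def toralReps : Set (RepVariety s) :=
  {ρ | ∃ C : Matrix (Fin 2) (Fin 2) ℂ, C.det = 0 ∧ C.trace = 1 ∧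
    ∃ w : Fin n → ℂ, IsLift (fun i => toralMatrix (w i) C) ρ}

variable {s}

lemma mem_unipotentReps_or_mem_toralReps {s : Fin 2 → G} {M : Fin 2 → Matrix (Fin 2) (Fin 2) ℂ}
    {ρ : RepVariety s} (hM : IsLift M ρ) (h : Commute (M 0) (M 1)) :
    ρ ∈ unipotentReps s ∨ ρ ∈ toralReps s := by
  obtain ⟨α, x, β, y, C, hC, htr, h0, h1⟩ := exists_common_of_commute h
  have hpencil : ∀ i, ∃ α x : ℂ, M i = α • 1 + x • C :=
    Fin.forall_fin_two.2 ⟨⟨α, x, h0⟩, ⟨β, y, h1⟩⟩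
  choose α x hαx using hpencil
  obtain rfl : M = fun i => α i • 1 + x i • C := funext hαx
  refine htr.imp (fun htr => ⟨C, hC, htr, fun i => α i * x i, hM.isLift_iff.2 fun i => ?_⟩)
    fun htr => ⟨C, hC, htr, fun i => α i + x i, ?_⟩
  · have hα := hM.det_eq_one i
    rw [det_smul_one_add_smul hC, htr, mul_zero, add_zero, mul_self_eq_one_iff] at hα
    rcases hα with hα | hα <;> simp only [hα]
    · exact Or.inl (by module)
    · exact Or.inr (by module)
  · convert hM using 2 with i
    exact (smul_one_add_smul_eq_toralMatrix hC htr (hM.det_eq_one i)).symm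

lemma finite_zero_or_one : {c : ℂ | c = 0 ∨ c = 1}.Finite :=
  Set.toFinite {0, 1}

lemma dimLT_unipotentReps : DimLT (repFunctions s) (n + 2) (unipotentReps s) := by
  have hdim := dimLT_mvPolynomialFunctions (k := ℂ) (σ := Option (Fin n))
  rw [Fintype.card_option, Fintype.card_fin] at hdim
  refine DimLT.of_finite_charts finite_zero_or_one
    (r := fun c z ρ => IsLift (fun i => 1 + rankOne 0 c (z none) (z (some i))) ρ)
    (fun c _ => ?_) hdim ?_
  · simpa only [Pi.one_apply, Pi.zero_apply, map_one, map_zero, one_smul, MvPolynomial.eval_C,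
      MvPolynomial.eval_X] using isRegularRel_chart (s := s) 1 1 0 (fun _ => MvPolynomial.C c)
        (fun _ => MvPolynomial.X none) fun i => MvPolynomial.X (some i)
  · rintro ρ ⟨C, hC, htr, x, hx⟩
    obtain ⟨c, u, v, hc, hCuv⟩ := exists_rankOne_eq hC
    refine ⟨c, hc, fun k => k.elim u fun i => x i * v, trivial, ?_⟩
    rw [htr] at hCuv
    simpa only [hCuv, smul_rankOne_zero, Option.elim_none, Option.elim_some] using hx

lemma isRegularRel_toralMatrix {σ : Type*} (w : Fin n → ℂ) (c u v : Fin n → MvPolynomial σ ℂ) :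
    IsRegularRel (mvPolynomialFunctions σ ℂ) (repFunctions s) fun z ρ =>
      IsLift (fun i => toralMatrix (w i) (rankOne 1 (MvPolynomial.eval z (c i))
        (MvPolynomial.eval z (u i)) (MvPolynomial.eval z (v i)))) ρ := by
  simpa only [toralMatrix, MvPolynomial.eval_C, Pi.one_apply, map_one] using
    isRegularRel_chart (s := s) (fun i => MvPolynomial.C (w i)⁻¹)
      (fun i => MvPolynomial.C (w i - (w i)⁻¹)) 1 c u v

lemma exists_root_pair_of_pow_eq {p t : ℕ} (ht : 0 < t) {a b : ℂ} (ha : a ≠ 0)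
    (h : a ^ p = b ^ t ∨ a ^ p = -b ^ t) :
    ∃ x ζ : ℂ, x ≠ 0 ∧ (ζ ^ t) ^ 2 = 1 ∧ a = x ^ t ∧ b = ζ * x ^ p := by
  obtain ⟨x, rfl⟩ := IsAlgClosed.exists_pow_nat_eq a ht
  have hx : x ≠ 0 := fun hx => ha (by rw [hx, zero_pow ht.ne'])
  refine ⟨x, b / x ^ p, hx, ?_, rfl, (div_mul_cancel₀ b (pow_ne_zero p hx)).symm⟩
  rw [div_pow, div_pow, div_eq_one_iff_eq (by positivity), eq_comm, sq_eq_sq_iff_eq_or_eq_neg,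
    ← pow_mul, mul_comm, pow_mul]
  exact h

end CommutingReps

section TorusGroupReps

open Matrix

variable {p t : ℕ}

lemma isRegularRel_toralMatrix_laurent {G : Type} [Group G] {n : ℕ} {s : Fin n → G}
    (ζ : Fin n → ℂ) (e : Fin n → ℕ) (c : ℂ) :
    IsRegularRel (mvPolynomialFunctions (Fin 4) ℂ) (repFunctions s) fun z ρ =>
      z 2 * z 3 = 1 ∧
        IsLift (fun i => toralMatrix (ζ i * z 2 ^ e i) (rankOne 1 c (z 0) (z 1))) ρ := by
  intro f hf
  obtain ⟨g, hg, hfg⟩ := isRegularRel_chart (s := s)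
    (fun i => MvPolynomial.C (ζ i)⁻¹ * MvPolynomial.X 3 ^ e i)
    (fun i => MvPolynomial.C (ζ i) * MvPolynomial.X 2 ^ e i -
      MvPolynomial.C (ζ i)⁻¹ * MvPolynomial.X 3 ^ e i)
    1 (fun _ => MvPolynomial.C c) (fun _ => MvPolynomial.X (0 : Fin 4))
    (fun _ => MvPolynomial.X 1) f hf
  refine ⟨g, hg, fun z ρ ⟨hz, hρ⟩ => hfg z ρ ?_⟩
  simpa only [toralMatrix, mul_inv, ← inv_pow, inv_eq_of_mul_eq_one_right hz, map_sub, map_mul,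
    map_pow, MvPolynomial.eval_C, MvPolynomial.eval_X, Pi.one_apply, map_one] using hρ

lemma dimLT_hyperbola : DimLT (mvPolynomialFunctions (Fin 4) ℂ) 4 {z | z 2 * z 3 = 1} := by
  have hmem : (fun z : Fin 4 → ℂ => z 2 * z 3 - 1) ∈ mvPolynomialFunctions (Fin 4) ℂ :=
    mem_mvPolynomialFunctions.2 ⟨MvPolynomial.X 2 * MvPolynomial.X 3 - 1, fun z => by
      simp only [map_sub, map_mul, map_one, MvPolynomial.eval_X]⟩
  refine (isDomainOn_mvPolynomialFunctions.dimLT_zeros dimLT_mvPolynomialFunctions hmem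
    ⟨0, trivial, ?_⟩).mono fun z hz => ⟨trivial, sub_eq_zero.2 hz⟩
  simp only [Pi.zero_apply, mul_zero, zero_sub, ne_eq, neg_eq_zero, one_ne_zero, not_false_iff]

lemma IsLift.pow_eq_of_toralMatrix {w : Fin 2 → ℂ} {C : Matrix (Fin 2) (Fin 2) ℂ}
    {ρ : RepVariety (torusGroupGen p t)} (hdet : C.det = 0) (htr : C.trace = 1)
    (h : IsLift (fun i => toralMatrix (w i) C) ρ) : w 0 ^ p = w 1 ^ t ∨ w 0 ^ p = -w 1 ^ t := by
  have hC := isIdempotentElem_of_det_eq_zero_of_trace_eq_one hdet htr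
  have heigen (a : ℂ) : (toralMatrix a C * C).trace = a := by
    rw [toralMatrix_mul_self hC, trace_smul, htr, smul_eq_mul, mul_one]
  have hpow := h.pow_eq
  rw [toralMatrix_pow hC, toralMatrix_pow hC] at hpow
  refine hpow.imp (fun hpow => ?_) fun hpow => ?_ <;>
    have htrace := congrArg (fun N => (N * C).trace) hpow
  · rwa [heigen, heigen] at htrace
  · rwa [neg_mul, trace_neg, heigen, heigen] at htrace

lemma dimLT_toralReps (ht : 0 < t) :
    DimLT (repFunctions (torusGroupGen p t)) 4 (toralReps (torusGroupGen p t)) := by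
  have hfin : {ζ : ℂ | (ζ ^ t) ^ 2 = 1}.Finite := by
    refine (Polynomial.nthRootsFinset (t * 2) (1 : ℂ)).finite_toSet.subset fun ζ hζ => ?_
    rw [Finset.mem_coe, Polynomial.mem_nthRootsFinset (by positivity), pow_mul]
    exact hζ
  refine DimLT.of_finite_charts (finite_zero_or_one.prod hfin)
    (fun i _ => isRegularRel_toralMatrix_laurent ![1, i.2] ![t, p] i.1) dimLT_hyperbola ?_
  rintro ρ ⟨C, hdet, htr, w, hw⟩
  have hw0 : w 0 ≠ 0 := fun h => by
    simpa [h, toralMatrix_zero] using hw.det_eq_one 0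
  obtain ⟨x, ζ, hx, hζ, h0, h1⟩ :=
    exists_root_pair_of_pow_eq ht hw0 (hw.pow_eq_of_toralMatrix hdet htr)
  obtain ⟨c, u, v, hc, hC⟩ := exists_rankOne_eq hdet
  refine ⟨(c, ζ), ⟨hc, hζ⟩, ![u, v, x, x⁻¹], mul_inv_cancel₀ hx, mul_inv_cancel₀ hx, ?_⟩
  convert hw using 2 with i
  rw [htr] at hC
  fin_cases i <;> simp [h0, h1, hC]

lemma pow_eq_one_or_of_not_commute {M : Fin 2 → Matrix (Fin 2) (Fin 2) ℂ}
    (hdet : (M 0).det = 1) (hcomm : ¬Commute (M 0) (M 1))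
    (hpow : M 0 ^ p = M 1 ^ t ∨ M 0 ^ p = -M 1 ^ t) : M 0 ^ p = 1 ∨ M 0 ^ p = -1 := by
  obtain ⟨a, ha⟩ : ∃ a : ℂ, M 0 ^ p = a • 1 := by
    by_contra! hne
    have hcomm1 : Commute (M 0 ^ p) (M 1) := by
      rcases hpow with h | h <;> rw [h]
      · exact (Commute.refl _).pow_left t
      · exact ((Commute.refl _).pow_left t).neg_left
    obtain ⟨a, b, h1⟩ := exists_eq_smul_one_add_smul_of_commute hcomm1 hne
    rw [h1] at hcomm
    exact hcomm <| ((Commute.one_right _).smul_right a).add_right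
      (((Commute.refl _).pow_right p).smul_right b)
  have ha2 : 1 = a ^ 2 := by
    have h := congrArg det ha
    rwa [det_pow, hdet, one_pow, det_smul, det_one, mul_one, Fintype.card_fin] at h
  rcases sq_eq_one_iff.1 ha2.symm with rfl | rfl
  · exact Or.inl (by rw [ha, one_smul])
  · exact Or.inr (by rw [ha, neg_smul, one_smul])

lemma trace_sq_mem_rotationTraces_of_not_commute (hp : 0 < p) (ht : 0 < t)
    {M : Fin 2 → Matrix (Fin 2) (Fin 2) ℂ} {ρ : RepVariety (torusGroupGen p t)} (hM : IsLift M ρ)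
    (hcomm : ¬Commute (M 0) (M 1)) : ∀ i, (M i).trace ^ 2 ∈ rotationTraces (![p, t] i) := by
  have h0 := pow_eq_one_or_of_not_commute (hM.det_eq_one 0) hcomm hM.pow_eq
  have h1 : M 1 ^ t = 1 ∨ M 1 ^ t = -1 := by
    rcases hM.pow_eq with h | h <;> rw [h] at h0
    · exact h0
    · exact h0.symm.imp neg_inj.1 neg_eq_iff_eq_neg.1
  refine Fin.forall_fin_two.2 ⟨?_, ?_⟩
  · exact trace_sq_mem_rotationTraces hp (hM.det_eq_one 0) h0 fun a ha => hcomm <| by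
      rw [ha]
      exact (Commute.one_left _).smul_left a
  · exact trace_sq_mem_rotationTraces ht (hM.det_eq_one 1) h1 fun a ha => hcomm <| by
      rw [ha]
      exact (Commute.one_right _).smul_right a

end TorusGroupReps

section TraceReps

open Matrix

section ArbitraryGroup

variable {G : Type} [Group G] {n : ℕ} {s : Fin n → G} {w : Fin n → ℂ}

lemma IsLift.mem_traceReps_of_toralMatrix {C : Fin n → Matrix (Fin 2) (Fin 2) ℂ}
    {ρ : RepVariety s} (htr : ∀ i, (C i).trace = 1)
    (h : IsLift (fun i => toralMatrix (w i) (C i)) ρ) :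
    ρ ∈ traceReps s fun i => (w i + (w i)⁻¹) ^ 2 :=
  ⟨_, h, fun i => by rw [trace_toralMatrix (htr i)]⟩

lemma exists_isLift_toralMatrix_rankOne (hw0 : ∀ i, w i ≠ 0) (hw1 : ∀ i, w i ^ 2 ≠ 1)
    {ρ : RepVariety s} (h : ρ ∈ traceReps s fun i => (w i + (w i)⁻¹) ^ 2) :
    ∃ c u v : Fin n → ℂ, (∀ i, c i = 0 ∨ c i = 1) ∧
      IsLift (fun i => toralMatrix (w i) (rankOne 1 (c i) (u i) (v i))) ρ := by
  obtain ⟨M, hM, htrM⟩ := exists_isLift_trace_eq h fun i => rfl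
  choose C hdet htr hMC using fun i =>
    exists_eq_toralMatrix (hM.det_eq_one i) (hw0 i) (hw1 i) (htrM i)
  choose c u v hc hC using fun i => exists_rankOne_eq (hdet i)
  refine ⟨c, u, v, hc, ?_⟩
  convert hM using 2 with i
  rw [hMC i, ← htr i, ← hC i]

lemma dimLT_traceReps (hw0 : ∀ i, w i ≠ 0) (hw1 : ∀ i, w i ^ 2 ≠ 1) :
    DimLT (repFunctions s) (n * 2 + 1) (traceReps s fun i => (w i + (w i)⁻¹) ^ 2) := by
  have hdim := dimLT_mvPolynomialFunctions (k := ℂ) (σ := Fin n × Fin 2)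
  rw [Fintype.card_prod, Fintype.card_fin, Fintype.card_fin] at hdim
  refine DimLT.of_finite_charts (Set.Finite.pi' fun _ : Fin n => finite_zero_or_one)
    (fun c _ => isRegularRel_toralMatrix w (fun i => MvPolynomial.C (c i))
      (fun i => MvPolynomial.X (i, 0)) fun i => MvPolynomial.X (i, 1)) hdim fun ρ hρ => ?_
  obtain ⟨c, u, v, hc, hcuv⟩ := exists_isLift_toralMatrix_rankOne hw0 hw1 hρ
  refine ⟨c, hc, fun k => ![u k.1, v k.1] k.2, trivial, ?_⟩
  simpa only [MvPolynomial.eval_C, MvPolynomial.eval_X, cons_val] using hcuv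

end ArbitraryGroup

variable {p t : ℕ} {w : Fin 2 → ℂ}

lemma exists_isLift_toralMatrix (hw0 : ∀ i, w i ≠ 0) (hw : ∀ i, (w i ^ 2) ^ ![p, t] i = 1)
    {C : Fin 2 → Matrix (Fin 2) (Fin 2) ℂ} (hdet : ∀ i, (C i).det = 0)
    (htr : ∀ i, (C i).trace = 1) :
    ∃ ρ : RepVariety (torusGroupGen p t), IsLift (fun i => toralMatrix (w i) (C i)) ρ := by
  have hC (i : Fin 2) := isIdempotentElem_of_det_eq_zero_of_trace_eq_one (hdet i) (htr i)
  refine exists_isLift_of_pow (fun i => det_toralMatrix (hdet i) (htr i) (hw0 i)) ?_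
  rcases toralMatrix_pow_eq_one_or (hC 0) (hw 0) with h0 | h0 <;>
    rcases toralMatrix_pow_eq_one_or (hC 1) (hw 1) with h1 | h1 <;>
    simp_all

lemma isIrreducible_traceReps (hw0 : ∀ i, w i ≠ 0) (hw : ∀ i, (w i ^ 2) ^ ![p, t] i = 1)
    (hw1 : ∀ i, w i ^ 2 ≠ 1) :
    IsIrreducible (traceReps (torusGroupGen p t) fun i => (w i + (w i)⁻¹) ^ 2) := by
  refine (isZariski_repFunctions _).isIrreducible_iff.2 <|
    (isRegularRel_toralMatrix w (fun i => MvPolynomial.X (i, (0 : Fin 3)))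
      (fun i => MvPolynomial.X (i, 1)) fun i => MvPolynomial.X (i, 2)).isDomainOn
    isDomainOn_mvPolynomialFunctions (fun z _ => ?_) fun ρ hρ => ?_
  · obtain ⟨ρ, hρ⟩ := exists_isLift_toralMatrix hw0 hw (fun i => det_rankOne _ _ _ _)
      fun i => trace_rankOne _ _ _ _
    exact ⟨ρ, hρ.mem_traceReps_of_toralMatrix fun i => trace_rankOne _ _ _ _, hρ⟩
  · obtain ⟨c, u, v, -, hcuv⟩ := exists_isLift_toralMatrix_rankOne hw0 hw1 hρ
    refine ⟨fun k => ![c k.1, u k.1, v k.1] k.2, trivial, ?_⟩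
    simpa only [MvPolynomial.eval_X, cons_val] using hcuv

lemma toralMatrix_rankOne_apply_add_one (w : ℂ) (a : Fin 2 → ℂ) (j : Fin 2) :
    toralMatrix w (rankOne 1 0 (a 0) (a 1)) (j + 1) j =
      (w - w⁻¹) * (a j * ![1 - a 0 * a 1, 1] j) := by
  fin_cases j <;> simp [toralMatrix, rankOne, vecMulVec]

lemma four_le_topologicalKrullDim_traceReps (hw0 : ∀ i, w i ≠ 0)
    (hw : ∀ i, (w i ^ 2) ^ ![p, t] i = 1) (hw1 : ∀ i, w i ^ 2 ≠ 1) :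
    (4 : ℕ) ≤ topologicalKrullDim (traceReps (torusGroupGen p t) fun i => (w i + (w i)⁻¹) ^ 2) := by
  let S := traceReps (torusGroupGen p t) fun i => (w i + (w i)⁻¹) ^ 2
  let M (z : Fin 2 × Fin 2 → ℂ) (i : Fin 2) : Matrix (Fin 2) (Fin 2) ℂ :=
    toralMatrix (w i) (rankOne 1 0 (z (i, 0)) (z (i, 1)))
  have hr : IsRegularRel (mvPolynomialFunctions (Fin 2 × Fin 2) ℂ)
      ((repFunctions _).map (pullback Subtype.val)) fun z (ρ : S) => IsLift (M z) ρ.1 := by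
    have hchart := isRegularRel_toralMatrix (s := torusGroupGen p t) w 0
      (fun i => MvPolynomial.X (i, (0 : Fin 2))) fun i => MvPolynomial.X (i, 1)
    simp only [MvPolynomial.eval_X, Pi.zero_apply, map_zero] at hchart
    exact hchart.comp_pullback Subtype.val
  have hM_apply (z : Fin 2 × Fin 2 → ℂ) (k : Fin 2 × Fin 2) : M z k.1 (k.2 + 1) k.2 =
      (w k.1 - (w k.1)⁻¹) * (z k * ![1 - z (k.1, 0) * z (k.1, 1), 1] k.2) :=
    toralMatrix_rankOne_apply_add_one (w k.1) (fun j => z (k.1, j)) k.2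
  choose f hf hfM using fun k : Fin 2 × Fin 2 =>
    exists_repFunction_entry_mul (s := torusGroupGen p t) k.1 (k.2 + 1) k.2 (k.2 + 1) k.2
  have hdim := ((isZariski_repFunctions _).of_isInducing
    Topology.IsInducing.subtypeVal).card_le_topologicalKrullDim hr
    (f := fun k => pullback Subtype.val (f k)) (fun z => ?_) (fun k => ⟨f k, hf k, rfl⟩)
    (fun k z ρ h hk => ?_) fun k z ρ h hk hk' => ?_
  · simpa only [Fintype.card_prod, Fintype.card_fin] using hdim
  · obtain ⟨ρ, hρ⟩ := exists_isLift_toralMatrix hw0 hw (fun i => det_rankOne _ _ _ _)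
      fun i => trace_rankOne _ _ _ _
    exact ⟨⟨ρ, hρ.mem_traceReps_of_toralMatrix fun i => trace_rankOne _ _ _ _⟩, hρ⟩
  · rw [pullback_apply, hfM k _ _ h, hM_apply, hk, zero_mul, mul_zero, zero_mul]
  · have hw' : w k.1 - (w k.1)⁻¹ ≠ 0 := fun h0 => hw1 k.1 <| by
      rw [sq]
      exact mul_eq_one_iff_eq_inv₀ (hw0 k.1) |>.2 (sub_eq_zero.1 h0)
    rw [pullback_apply, hfM k _ _ h, hM_apply, hk, one_mul]
    refine mul_self_ne_zero.2 (mul_ne_zero hw' ?_)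
    obtain ⟨i, j⟩ := k
    fin_cases j
    · simp [hk' (i, 1)]
    · simp

lemma topologicalKrullDim_traceReps (hw0 : ∀ i, w i ≠ 0)
    (hw : ∀ i, (w i ^ 2) ^ ![p, t] i = 1) (hw1 : ∀ i, w i ^ 2 ≠ 1) :
    topologicalKrullDim (traceReps (torusGroupGen p t) fun i => (w i + (w i)⁻¹) ^ 2) =
      (4 : ℕ) :=
  le_antisymm
    ((isZariski_repFunctions _).topologicalKrullDim_subtype_le (dimLT_traceReps hw0 hw1))
    (four_le_topologicalKrullDim_traceReps hw0 hw hw1)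

lemma exists_eq_of_mem_rotationTraces (hp : 0 < p) (ht : 0 < t) {τ : Fin 2 → ℂ}
    (hτ : ∀ i, τ i ∈ rotationTraces (![p, t] i)) :
    ∃ w : Fin 2 → ℂ, (∀ i, w i ≠ 0) ∧ (∀ i, (w i ^ 2) ^ ![p, t] i = 1) ∧ (∀ i, w i ^ 2 ≠ 1) ∧
      τ = fun i => (w i + (w i)⁻¹) ^ 2 := by
  have hpt : ∀ i, 0 < ![p, t] i := Fin.forall_fin_two.2 ⟨hp, ht⟩
  choose w hw hw1 hwτ using fun i => (mem_rotationTraces (hpt i)).1 (hτ i)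
  refine ⟨w, fun i h => ?_, hw, hw1, funext fun i => (hwτ i).symm⟩
  have hwi := hw i
  rw [h, zero_pow two_ne_zero, zero_pow (hpt i).ne'] at hwi
  exact zero_ne_one hwi

end TraceReps

section Components

variable {p t : ℕ}

lemma isIrreducible_traceReps_of_mem_rotationTraces (hp : 0 < p) (ht : 0 < t) {τ : Fin 2 → ℂ}
    (hτ : ∀ i, τ i ∈ rotationTraces (![p, t] i)) :
    IsIrreducible (traceReps (torusGroupGen p t) τ) := by
  obtain ⟨w, hw0, hw, hw1, rfl⟩ := exists_eq_of_mem_rotationTraces hp ht hτ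
  exact isIrreducible_traceReps hw0 hw hw1

lemma topologicalKrullDim_traceReps_of_mem_rotationTraces (hp : 0 < p) (ht : 0 < t)
    {τ : Fin 2 → ℂ} (hτ : ∀ i, τ i ∈ rotationTraces (![p, t] i)) :
    topologicalKrullDim (traceReps (torusGroupGen p t) τ) = (4 : ℕ) := by
  obtain ⟨w, hw0, hw, hw1, rfl⟩ := exists_eq_of_mem_rotationTraces hp ht hτ
  exact topologicalKrullDim_traceReps hw0 hw hw1

lemma eq_of_traceReps_subset {G : Type} [Group G] {n : ℕ} {s : Fin n → G} {τ τ' : Fin n → ℂ}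
    (hne : (traceReps s τ).Nonempty) (h : traceReps s τ ⊆ traceReps s τ') : τ = τ' :=
  hne.elim fun _ hρ => eq_of_mem_traceReps hρ (h hρ)

lemma irreducibleComponents_torusGroup_eq (hp : 0 < p) (ht : 0 < t) :
    {Z ∈ irreducibleComponents (RepVariety (torusGroupGen p t)) |
      topologicalKrullDim Z = (4 : ℕ)} =
    traceReps (torusGroupGen p t) ''
      (Fintype.piFinset fun i => rotationTraces (![p, t] i) : Finset (Fin 2 → ℂ)) := by
  refine (isZariski_repFunctions _).irreducibleComponents_topologicalKrullDim_eq
    (dimLT_unipotentReps.union (dimLT_toralReps ht)) (Finset.finite_toSet _)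
    (fun τ _ => isClosed_traceReps _ τ)
    (fun τ hτ => isIrreducible_traceReps_of_mem_rotationTraces hp ht (Fintype.mem_piFinset.1 hτ))
    (fun τ hτ => topologicalKrullDim_traceReps_of_mem_rotationTraces hp ht
      (Fintype.mem_piFinset.1 hτ))
    (fun τ hτ τ' _ h => ?_) fun ρ => ?_
  · have hirr := isIrreducible_traceReps_of_mem_rotationTraces hp ht (Fintype.mem_piFinset.1 hτ)
    rw [eq_of_traceReps_subset hirr.nonempty h]
  · obtain ⟨M, hM⟩ := exists_isLift ρ
    by_cases hcomm : Commute (M 0) (M 1)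
    · exact Or.inl (mem_unipotentReps_or_mem_toralReps hM hcomm)
    · exact Or.inr ⟨_, Fintype.mem_piFinset.2
        (trace_sq_mem_rotationTraces_of_not_commute hp ht hM hcomm), M, hM, fun i => rfl⟩

lemma numComponents_torusGroup (hp : 0 < p) (ht : 0 < t) :
    numComponents (RepVariety (torusGroupGen p t)) 4 = (p / 2 * (t / 2) : ℕ) := by
  have hinj : Set.InjOn (traceReps (torusGroupGen p t))
      (Fintype.piFinset fun i => rotationTraces (![p, t] i) : Finset (Fin 2 → ℂ)) :=
    fun τ hτ τ' _ h => eq_of_traceReps_subset (isIrreducible_traceReps_of_mem_rotationTraces hp ht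
      (Fintype.mem_piFinset.1 hτ)).nonempty h.subset
  rw [numComponents, irreducibleComponents_torusGroup_eq hp ht, hinj.encard_image,
    Set.encard_coe_eq_coe_finsetCard, Fintype.card_piFinset, Fin.prod_univ_two,
    card_rotationTraces, card_rotationTraces]
  rfl

end Components

section HalfCast

variable {K : Type*} [DivisionRing K] [NeZero (2 : K)] {n : ℕ}

lemma cast_half_of_odd (h : Odd n) : ((n / 2 : ℕ) : K) = (n - 1) / 2 := by
  rw [eq_div_iff two_ne_zero, eq_sub_iff_add_eq]
  exact_mod_cast congrArg (Nat.cast : ℕ → K) (Nat.div_two_mul_two_add_one_of_odd h)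

lemma cast_half_of_even (h : Even n) : ((n / 2 : ℕ) : K) = n / 2 := by
  rw [eq_div_iff two_ne_zero]
  exact_mod_cast congrArg (Nat.cast : ℕ → K) (Nat.div_two_mul_two_of_even h)

end HalfCast

theorem proposition4p3 (p t : ℕ) (hp : 0 < p) (ht : 0 < t) :
    ∃ N : ℕ, numComponents (RepVariety (torusGroupGen p t)) 4 = (N : ℕ∞) ∧
      (Odd p → Odd t → (N : ℚ) = ((p : ℚ) - 1) * ((t : ℚ) - 1) / 4) ∧
      (Even p → Odd t → (N : ℚ) = (p : ℚ) * ((t : ℚ) - 1) / 4) ∧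
      (Odd p → Even t → (N : ℚ) = (t : ℚ) * ((p : ℚ) - 1) / 4) ∧
      (Even p → Even t → (N : ℚ) = (p : ℚ) * (t : ℚ) / 4) := by
  refine ⟨p / 2 * (t / 2), numComponents_torusGroup hp ht, fun hp ht => ?_, fun hp ht => ?_,
    fun hp ht => ?_, fun hp ht => ?_⟩ <;> rw [Nat.cast_mul]
  · rw [cast_half_of_odd hp, cast_half_of_odd ht]
    ring
  · rw [cast_half_of_even hp, cast_half_of_odd ht]
    ring
  · rw [cast_half_of_odd hp, cast_half_of_even ht]
    ring
  · rw [cast_half_of_even hp, cast_half_of_even ht]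
    ring
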